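/- Let $k\ge 2$ and $n\ge 0$ be integers and let $0\le\theta<1$. Let $\Gamma^k=(V,L)$ be the Cayley tree of order $k$, i.e. the infinite tree in which every vertex has exactly $k+1$ neighbours, with a fixed root $x^0\in V$; let $V_m$ and $W_m$ be the disk and the sphere of radius $m$ around $x^0$ in the graph distance. For $u,v\in[0,1]$ put $$\xi_{u,v}=\log\Bigl(1+\theta\,\sqrt[2n+1]{4(u-\tfrac12)(v-\tfrac12)}\Bigr),$$ with the real odd root, and for a configuration $\sigma\in[0,1]^{V_m}$ put $H(\sigma)=-\sum_{\langle x,y\rangle}\xi_{\sigma(x),\sigma(y)}$, the sum running once over each edge with both endpoints in $V_m$. A probability measure $\mu$ on $[0,1]^V$ (with the product $\sigma$-algebra) is called a splitting Gibbs measure (at $\beta=1$) if there are measurable functions $h_x:[0,1]\to\mathbb R$, $x\in V\setminus\{x^0\}$, such that for every $m\ge1$ the marginal of $\mu$ on $[0,1]^{V_m}$ has the density $$\frac1{Z_m}\exp\Bigl(-H(\sigma)+\sum_{x\in W_m}h_x(\sigma(x))\Bigr)$$ with respect to Lebesgue measure on $[0,1]^{V_m}$, where $0<Z_m<\infty$ is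 the normalizing constant. It is called translation-invariant if it is invariant under all automorphisms of the tree. Set $$\theta_c=\frac{2n+3}{k(2n+1)}.$$ Then: 1. if $\theta\le\theta_c$, there is exactly one translation-invariant splitting Gibbs measure; 2. if $\theta_c<\theta$, there are exactly three translation-invariant splitting Gibbs measures. -/

import Mathlib

open MeasureTheory

/-- The real root of odd order `2n+1`: the unique real `r` with `r ^ (2n+1) = x`. -/
noncomputable def oddRoot (n : ℕ) (x : ℝ) : ℝ :=
  Real.sign x * |x| ^ (1 / (2 * (n : ℝ) + 1))

theorem oddRoot_pow (n : ℕ) (x : ℝ) : oddRoot n x ^ (2 * n + 1) = x := by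
  have h : (|x| ^ (1 / (2 * (n : ℝ) + 1))) ^ (2 * n + 1) = |x| := by
    rw [one_div, show (2 * (n : ℝ) + 1) = ((2 * n + 1 : ℕ) : ℝ) by push_cast; ring]
    exact Real.rpow_inv_natCast_pow (abs_nonneg x) (by omega)
  rw [oddRoot, mul_pow, h]
  rcases lt_trichotomy x 0 with hx | hx | hx
  · rw [Real.sign_of_neg hx, abs_of_neg hx, pow_succ, pow_mul]; norm_num
  · simp [hx]
  · rw [Real.sign_of_pos hx, abs_of_pos hx]; simp

/-- The interaction `ξ_{u,v} = log (1 + θ (4 (u - 1/2) (v - 1/2)) ^ (1/(2n+1)))`, a function of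
the unordered pair of the spins at the two endpoints of an edge. -/
noncomputable def potential (n : ℕ) (θ : ℝ) : Sym2 unitInterval → ℝ :=
  Sym2.lift ⟨fun u v => Real.log (1 + θ * oddRoot n (4 * ((u : ℝ) - 1 / 2) * ((v : ℝ) - 1 / 2))),
    fun u v => by simp only [mul_right_comm]⟩

section CayleyTree

variable {V : Type*} (G : SimpleGraph V)

/-- The disk `V_n` of radius `n` around `x₀`, in the graph distance. -/
def disk (x₀ : V) (n : ℕ) : Set V := {x | G.edist x₀ x ≤ n}

theorem disk_finite [G.LocallyFinite] (x₀ : V) (n : ℕ) : (disk G x₀ n).Finite := by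
  induction n with
  | zero =>
    refine (Set.finite_singleton x₀).subset fun x hx => ?_
    have h : G.edist x₀ x = 0 := nonpos_iff_eq_zero.mp (by exact_mod_cast hx)
    exact (SimpleGraph.edist_eq_zero_iff.mp h).symm
  | succ n ih =>
    refine ((Set.finite_singleton x₀).union
      (ih.biUnion fun y _ => (G.neighborSet y).toFinite)).subset fun x hx => ?_
    have hx' : G.edist x₀ x ≤ ((n + 1 : ℕ) : ℕ∞) := hx
    have hr : G.edist x x₀ ≠ ⊤ := by
      rw [SimpleGraph.edist_comm]; exact ne_top_of_le_ne_top (ENat.natCast_ne_top _) hx'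
    obtain ⟨p, hp⟩ := SimpleGraph.exists_walk_of_edist_ne_top hr
    cases p with
    | nil => exact Or.inl rfl
    | cons hadj q =>
      rename_i y
      refine Or.inr (Set.mem_biUnion (x := y) ?_ hadj.symm)
      rw [SimpleGraph.edist_comm, ← hp, SimpleGraph.Walk.length_cons] at hx'
      have hq : q.length ≤ n := by
        have := ENat.natCast_le_natCast.mp hx'
        omega
      have : G.edist x₀ y ≤ (q.length : ℕ∞) := by
        rw [SimpleGraph.edist_comm]; exact q.edist_le
      exact this.trans (by exact_mod_cast hq)

noncomputable instance fintypeDisk [G.LocallyFinite] (x₀ : V) (n : ℕ) : Fintype (disk G x₀ n) :=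
  (disk_finite G x₀ n).fintype

open Classical in
/-- The energy `H(σ) = - ∑ ξ_{σ(x),σ(y)}` of a configuration on `V_n`; the sum runs over the edges
with both endpoints in `V_n`, each of them counted once. -/
noncomputable def hamiltonian [G.LocallyFinite] (ξ : Sym2 unitInterval → ℝ) (x₀ : V) (n : ℕ)
    (σ : disk G x₀ n → unitInterval) : ℝ :=
  -∑ e ∈ (G.induce (disk G x₀ n)).edgeFinset, ξ (e.map σ)

open Classical in
/-- The unnormalized finite-volume measure on `[0,1]^{V_n}` with density
`exp (-β H(σ) + ∑_{x ∈ W_n} h_x(σ(x)))` with respect to Lebesgue measure, where `W_n` is the sphere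
of radius `n` around `x₀`. -/
noncomputable def weightMeasure [G.LocallyFinite] (ξ : Sym2 unitInterval → ℝ) (β : ℝ) (x₀ : V)
    (h : V → unitInterval → ℝ) (n : ℕ) : Measure (disk G x₀ n → unitInterval) :=
  (Measure.pi fun _ => (volume : Measure unitInterval)).withDensity fun σ =>
    ENNReal.ofReal (Real.exp (-β * hamiltonian G ξ x₀ n σ +
      ∑ x ∈ Finset.univ.filter (fun x : disk G x₀ n => G.edist x₀ (x : V) = n), h x (σ x)))

/-- The finite-volume distribution `μ^{(n)}` with boundary function `h`. If the total mass `Z_n` is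
infinite, this is the zero measure. -/
noncomputable def finiteVolumeMeasure [G.LocallyFinite] (ξ : Sym2 unitInterval → ℝ) (β : ℝ) (x₀ : V)
    (h : V → unitInterval → ℝ) (n : ℕ) : Measure (disk G x₀ n → unitInterval) :=
  (weightMeasure G ξ β x₀ h n Set.univ)⁻¹ • weightMeasure G ξ β x₀ h n

/-- A splitting Gibbs measure: a probability measure on `[0,1]^V` whose marginals on the disks `V_n`,
`n ≥ 1`, are the finite-volume distributions of one family of boundary functions `h_x`, `x ≠ x₀`
(which may depend on the vertex `x`; the value of `h` at `x₀` is never used). In particular these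
finite-volume distributions are consistent, with finite normalizations `Z_n`. -/
def IsSplittingGibbs [G.LocallyFinite] (ξ : Sym2 unitInterval → ℝ) (β : ℝ) (x₀ : V)
    (μ : Measure (V → unitInterval)) : Prop :=
  IsProbabilityMeasure μ ∧ ∃ h : V → unitInterval → ℝ, (∀ x, Measurable (h x)) ∧
    ∀ n : ℕ, 1 ≤ n →
      μ.map (Set.domRestrict (disk G x₀ n)) = finiteVolumeMeasure G ξ β x₀ h n

/-- Invariance of a measure on configurations under the automorphisms of the tree. -/
def IsTranslationInvariant (μ : Measure (V → unitInterval)) : Prop :=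
  ∀ φ : G ≃g G, μ.map (fun σ x => σ (φ x)) = μ

end CayleyTree

/-! Since 4(u - 1/2)(v - 1/2) = (2u - 1)(2v - 1) and odd roots are multiplicative, the edge weight
is 1 + θ t(u) t(v), where t = `spin` takes values in [-1, 1]. Integrating one end of an edge against
a nonzero finite measure Λ therefore gives a positive multiple of 1 + s t(u), with s equal to θ
times the mean of t under Λ: a single real parameter replaces a boundary function
(`exists_lintegral_kernel_eq`).

Let μ be a translation-invariant splitting Gibbs measure. The law Λ of the spin at x with the
interaction towards a neighbour p divided out (`condMeasure`) is the same for all directed edges,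
because automorphisms act transitively on these (`exists_iso_of_adj`). If x lies on the sphere, Λ
has density proportional to exp h_x; if the radius is one larger, integrating out the k outer
neighbours of x shows that the density is proportional to (1 + s t)^k. Hence the boundary functions
are known up to constants and null sets, and s solves s ∫ (1 + s t)^k = θ ∫ t (1 + s t)^k
(`exists_isFixed_of_isSplittingGibbs`). Conversely, a solution with |s| < 1 defines weights that are
consistent under removal of pendant vertices (`lintegral_treeWeight_insert`). Compactness then gives
a measure, and consistency around every centre gives its invariance. As s can be read off from Λ,
solutions and measures correspond bijectively (`exists_equiv_isFixed`).

It remains to count solutions. The difference of the two sides is s P(s) with P an even polynomial.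
Up to positive factors its even coefficients change sign at most once, from negative to positive
(`coeffSign_pos`), and the constant one is nonnegative exactly when θ ≤ θ_c. In that case P has no
nonzero root. Otherwise P(0) < 0 < P(1), so P has exactly one positive root z, it is less than 1,
and the solutions are 0, z, -z. -/

namespace CayleyTree

/-! ### Parents, balls and removal of pendant vertices in a tree. -/

section Graph

open Classical in
/-- The finite ball of radius `m` around `r`. -/
noncomputable def ball {V : Type*} (G : SimpleGraph V) [G.LocallyFinite] (r : V) (m : ℕ) :
    Finset V := (disk G r m).toFinset

variable {V : Type*} {G : SimpleGraph V}

theorem mem_ball [G.LocallyFinite] (hG : G.IsTree) {r : V} {m : ℕ} {x : V} :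
    x ∈ ball G r m ↔ G.dist r x ≤ m := by
  rw [ball, Set.mem_toFinset, disk, Set.mem_ofPred_eq,
    ← (hG.connected.preconnected r x).coe_dist_eq_edist]
  exact_mod_cast Iff.rfl

theorem coe_ball [G.LocallyFinite] (r : V) (m : ℕ) :
    (ball G r m : Set V) = disk G r m := by
  simp [ball]

theorem exists_lower_adj (hG : G.IsTree) {r x : V} (hx : x ≠ r) :
    ∃ p, G.Adj x p ∧ G.dist r x = G.dist r p + 1 := by
  obtain ⟨w, hw⟩ := hG.connected.exists_walk_length_eq_dist x r
  cases w with
  | nil => exact absurd rfl hx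
  | cons h w =>
    rename_i y
    refine ⟨y, h, ?_⟩
    have h1 := G.dist_le w
    rw [SimpleGraph.Walk.length_cons] at hw
    rw [SimpleGraph.dist_comm (u := y)] at h1
    rw [SimpleGraph.dist_comm (u := x)] at hw
    rcases hG.dist_eq_dist_add_one_of_adj r h with h' | h' <;> omega

/-- A shortest path to `p` extended by `x` is the unique path from `r` to `x`, and every walk
contains that path. -/
theorem lower_mem_support (hG : G.IsTree) {r x p : V} (hxp : G.Adj x p)
    (hd : G.dist r x = G.dist r p + 1) (w : G.Walk r x) : p ∈ w.support := by
  classical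
  obtain ⟨q, hq, hql⟩ := hG.connected.exists_path_of_dist r p
  have hc : (q.concat hxp.symm).IsPath := by
    apply SimpleGraph.Walk.isPath_of_length_eq_dist
    rw [SimpleGraph.Walk.length_concat, hql, hd]
  apply w.support_bypass_subset_support
  have he : q.concat hxp.symm = w.bypass := congrArg Subtype.val
    ((hG.isAcyclic.subsingleton_path r x).elim ⟨_, hc⟩ ⟨_, w.bypass_isPath⟩)
  rw [← he]
  exact SimpleGraph.Walk.support_subset_support_concat _ _ q.end_mem_support

theorem lower_unique (hG : G.IsTree) {r x p q : V} (hxp : G.Adj x p)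
    (hp : G.dist r x = G.dist r p + 1) (hxq : G.Adj x q) (hq : G.dist r x = G.dist r q + 1) :
    p = q := by
  obtain ⟨w, hw⟩ := hG.connected.exists_path_of_dist r x
  rw [hG.isAcyclic.eq_penultimate_of_adj_end hw.1 hxp (lower_mem_support hG hxp hp w),
    hG.isAcyclic.eq_penultimate_of_adj_end hw.1 hxq (lower_mem_support hG hxq hq w)]

/-- The walk from `b` to `y` through the centre `r` stays in the ball and must pass through the
parent of `y` as seen from `b`. This allows a ball around `r` to be peeled towards another centre
`b`. -/
theorem ball_lower_closed [G.LocallyFinite] (hG : G.IsTree) {r b : V} {m : ℕ}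
    (hb : b ∈ ball G r m) {y p : V} (hy : y ∈ ball G r m) (hyp : G.Adj y p)
    (hd : G.dist b y = G.dist b p + 1) : p ∈ ball G r m := by
  classical
  rw [mem_ball hG] at hb hy ⊢
  obtain ⟨w₁, h₁⟩ := hG.connected.exists_walk_length_eq_dist r b
  obtain ⟨w₂, h₂⟩ := hG.connected.exists_walk_length_eq_dist r y
  have hs := lower_mem_support hG hyp hd (w₁.reverse.append w₂)
  rw [SimpleGraph.Walk.mem_support_append_iff, SimpleGraph.Walk.support_reverse,
    List.mem_reverse] at hs
  rcases hs with hs | hs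
  · have := G.dist_le (w₁.takeUntil p hs)
    have := w₁.length_takeUntil_le_length hs
    omega
  · have := G.dist_le (w₂.takeUntil p hs)
    have := w₂.length_takeUntil_le_length hs
    omega

open Classical in
/-- Removing pendant vertices one at a time, one can pass from a finite set closed under steps
towards `b` to any ball around `b` contained in it. -/
theorem peel_induction [G.LocallyFinite] (hG : G.IsTree) {b : V} {j : ℕ} {P : Finset V → Prop}
    (hP : ∀ (A : Finset V) (x y : V), ball G b j ⊆ A → y ∉ A → x ∈ A → G.Adj x y →
      (∀ z ∈ A, G.Adj y z → z = x) → P (insert y A) → P A)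
    (B : Finset V) (hjB : ball G b j ⊆ B)
    (hB : ∀ y ∈ B, ∀ p, G.Adj y p → G.dist b y = G.dist b p + 1 → p ∈ B) (h : P B) :
    P (ball G b j) := by
  induction hn : (B \ ball G b j).card generalizing B with
  | zero =>
    rw [Finset.card_eq_zero, Finset.sdiff_eq_empty_iff_subset] at hn
    rwa [hjB.antisymm hn]
  | succ n ih =>
    -- A vertex farthest from `b` has its parent as its only neighbour in `B`, so it is pendant.
    obtain ⟨y, hy, hmax⟩ := (B \ ball G b j).exists_max_image (G.dist b)
      (Finset.card_pos.mp (by omega))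
    rw [Finset.mem_sdiff] at hy
    have hyb : y ≠ b := by
      rintro rfl
      exact hy.2 ((mem_ball hG).mpr (by simp))
    obtain ⟨x, hyx, hd⟩ := exists_lower_adj hG hyb
    have hxB : x ∈ B := hB y hy.1 x hyx hd
    have hle : ∀ z ∈ B, G.dist b z ≤ G.dist b y := by
      intro z hz
      by_cases hzb : z ∈ ball G b j
      · rw [mem_ball hG] at hzb
        have := hy.2
        rw [mem_ball hG] at this
        omega
      · exact hmax z (Finset.mem_sdiff.mpr ⟨hz, hzb⟩)
    have hjB' : ball G b j ⊆ B.erase y := fun z hz =>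
      Finset.mem_erase.mpr ⟨fun h => hy.2 (h ▸ hz), hjB hz⟩
    apply ih (B.erase y) hjB'
    · intro z hz p hzp hdz
      rw [Finset.mem_erase] at hz ⊢
      refine ⟨?_, hB z hz.2 p hzp hdz⟩
      rintro rfl
      have := hle z hz.2
      omega
    · refine hP (B.erase y) x y hjB' (by simp) (Finset.mem_erase.mpr ⟨hyx.ne.symm, hxB⟩) hyx.symm ?_
        (by rwa [Finset.insert_erase hy.1])
      intro z hz hyz
      rw [Finset.mem_erase] at hz
      refine lower_unique hG hyz ?_ hyx hd
      have := hle z hz.2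
      rcases hG.dist_eq_dist_add_one_of_adj b hyz with h' | h' <;> omega
    · have : B.erase y \ ball G b j = (B \ ball G b j).erase y := by
        ext z; simp only [Finset.mem_sdiff, Finset.mem_erase]; tauto
      rw [this, Finset.card_erase_of_mem (Finset.mem_sdiff.mpr hy), hn]; rfl

theorem countable_of_connected [G.LocallyFinite] (hG : G.IsTree) (r : V) : Countable V := by
  have : (⋃ m, disk G r m) = Set.univ := by
    refine Set.eq_univ_of_forall fun x => Set.mem_iUnion.mpr ⟨G.dist r x, ?_⟩
    rw [← coe_ball, Finset.mem_coe, mem_ball hG]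
  rw [← Set.countable_univ_iff, ← this]
  exact Set.countable_iUnion fun m => (disk_finite G r m).countable

end Graph

/-! ### Edges inside a finite vertex set. -/

section EdgesIn

variable {V : Type*} (G : SimpleGraph V)

open Classical in
/-- The edges with both endpoints in `A`. -/
noncomputable def edgesIn (A : Finset V) : Finset (Sym2 V) := A.sym2.filter (· ∈ G.edgeSet)

variable {G}

theorem mem_edgesIn {A : Finset V} {x y : V} :
    s(x, y) ∈ edgesIn G A ↔ x ∈ A ∧ y ∈ A ∧ G.Adj x y := by
  simp [edgesIn, and_assoc]

theorem edgesIn_insert [DecidableEq V] [DecidableEq (Sym2 V)] {A : Finset V} {x y : V} (hx : x ∈ A)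
    (hxy : G.Adj x y) (hu : ∀ z ∈ A, G.Adj y z → z = x) :
    edgesIn G (insert y A) = insert s(x, y) (edgesIn G A) := by
  ext e
  induction e with | _ a b
  simp only [mem_edgesIn, Finset.mem_insert, Sym2.eq_iff]
  constructor
  · rintro ⟨rfl | ha, rfl | hb, hab⟩
    · exact absurd hab (G.irrefl)
    · exact Or.inl (Or.inr ⟨rfl, hu _ hb hab⟩)
    · exact Or.inl (Or.inl ⟨hu _ ha hab.symm, rfl⟩)
    · exact Or.inr ⟨ha, hb, hab⟩
  · rintro ((⟨rfl, rfl⟩ | ⟨rfl, rfl⟩) | ⟨ha, hb, hab⟩)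
    · exact ⟨Or.inr hx, Or.inl rfl, hxy⟩
    · exact ⟨Or.inl rfl, Or.inr hx, hxy.symm⟩
    · exact ⟨Or.inr ha, Or.inr hb, hab⟩

theorem notMem_edgesIn {A : Finset V} {x y : V} (hy : y ∉ A) : s(x, y) ∉ edgesIn G A := by
  rw [mem_edgesIn]; tauto

theorem edgesIn_map (φ : G ≃g G) (A : Finset V) :
    edgesIn G (A.map φ.toEquiv.toEmbedding) =
      (edgesIn G A).map φ.toEquiv.toEmbedding.sym2Map := by
  ext e
  constructor
  · induction e with | _ a b
    intro h
    rw [mem_edgesIn] at h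
    obtain ⟨ha, hb, hab⟩ := h
    obtain ⟨a, ha', rfl⟩ := Finset.mem_map.mp ha
    obtain ⟨b, hb', rfl⟩ := Finset.mem_map.mp hb
    exact Finset.mem_map.mpr ⟨s(a, b), mem_edgesIn.mpr ⟨ha', hb', φ.map_rel_iff.mp hab⟩, rfl⟩
  · intro h
    obtain ⟨e, he, rfl⟩ := Finset.mem_map.mp h
    induction e with | _ a b
    rw [mem_edgesIn] at he
    exact mem_edgesIn.mpr ⟨Finset.mem_map_of_mem _ he.1, Finset.mem_map_of_mem _ he.2.1,
      φ.map_rel_iff.mpr he.2.2⟩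

end EdgesIn

/-! ### Transitivity of the automorphism group on directed edges. -/

section Transitive

variable {V : Type*} {G : SimpleGraph V}

/-- The local step in building an automorphism: neighbourhoods have equal size, and a transposition
corrects the image of `p`. -/
theorem exists_bijOn_neighborSet [G.LocallyFinite] {d : ℕ} (hreg : G.IsRegularOfDegree d)
    {p x p' x' : V} (h : G.Adj x p) (h' : G.Adj x' p') :
    ∃ f : V → V, Set.BijOn f (G.neighborSet x) (G.neighborSet x') ∧ f p = p' := by
  classical
  have hc : Fintype.card (G.neighborSet x) = Fintype.card (G.neighborSet x') := by
    rw [SimpleGraph.card_neighborSet_eq_degree, SimpleGraph.card_neighborSet_eq_degree, hreg x,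
      hreg x']
  let e := Fintype.equivOfCardEq hc
  let e' := e.trans (Equiv.swap (e ⟨p, h⟩) ⟨p', h'⟩)
  have hval : ∀ y (hy : y ∈ G.neighborSet x),
      (fun y => if hy : y ∈ G.neighborSet x then (e' ⟨y, hy⟩ : V) else y) y = e' ⟨y, hy⟩ :=
    fun y hy => dif_pos hy
  refine ⟨fun y => if hy : y ∈ G.neighborSet x then (e' ⟨y, hy⟩ : V) else y, ⟨?_, ?_, ?_⟩, ?_⟩
  · intro y hy
    rw [hval y hy]
    exact (e' ⟨y, hy⟩).2
  · intro y hy z hz hyz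
    rw [hval y hy, hval z hz] at hyz
    simpa using e'.injective (Subtype.ext hyz)
  · intro z hz
    refine ⟨e'.symm ⟨z, hz⟩, (e'.symm ⟨z, hz⟩).2, ?_⟩
    rw [hval _ (e'.symm ⟨z, hz⟩).2]
    simp
  · rw [hval p h]
    simp [e']

/-- A map between trees which is bijective on neighbourhoods is an automorphism. -/
theorem bijective_of_bijOn_neighborSet (hG : G.IsTree) {f : V → V}
    (hf : ∀ x, Set.BijOn f (G.neighborSet x) (G.neighborSet (f x))) : Function.Bijective f := by
  obtain ⟨a⟩ := hG.connected.nonempty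
  have hadj : ∀ {x y}, G.Adj x y → G.Adj (f x) (f y) := fun {x y} h => (hf x).1 h
  have hdist : ∀ n x, G.dist a x ≤ n → G.dist (f a) (f x) = G.dist a x := by
    intro n
    induction n with
    | zero =>
      intro x hx
      obtain rfl : a = x := hG.connected.dist_eq_zero_iff.mp (by omega)
      simp
    | succ n ih =>
      intro x hx
      by_cases hxa : x = a
      · subst hxa; simp
      obtain ⟨p, hxp, hp⟩ := exists_lower_adj hG hxa
      have ihp := ih p (by omega)
      rcases hG.dist_eq_dist_add_one_of_adj (f a) (hadj hxp) with h | h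
      · omega
      -- If the image folded back at `p`, then `x` and the parent `q` of `p` would have the same
      -- image, against injectivity of `f` around `p`.
      · exfalso
        by_cases hpa : p = a
        · subst hpa; simp at h
        obtain ⟨q, hpq, hq⟩ := exists_lower_adj hG hpa
        have ihq := ih q (by omega)
        have : f x = f q := lower_unique hG (hadj hxp.symm) h (hadj hpq) (by omega)
        have : x = q := (hf p).2.1 hxp.symm hpq this
        subst this
        omega
  have hdist' : ∀ x, G.dist (f a) (f x) = G.dist a x := fun x => hdist _ x le_rfl
  constructor
  · have : ∀ n x y, G.dist a x = n → f x = f y → x = y := by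
      intro n
      induction n with
      | zero =>
        intro x y hx hxy
        have hy : G.dist a y = 0 := by rw [← hdist', ← hxy, hdist', hx]
        rw [← hG.connected.dist_eq_zero_iff.mp hx, ← hG.connected.dist_eq_zero_iff.mp hy]
      | succ n ih =>
        intro x y hx hxy
        have hy : G.dist a y = n + 1 := by rw [← hdist', ← hxy, hdist', hx]
        obtain ⟨p, hxp, hp⟩ := exists_lower_adj hG (r := a) (x := x) (by rintro rfl; simp at hx)
        obtain ⟨q, hyq, hq⟩ := exists_lower_adj hG (r := a) (x := y) (by rintro rfl; simp at hy)
        have hpq : f p = f q := by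
          refine lower_unique hG (r := f a) (hadj hxp) ?_ (hxy ▸ hadj hyq) ?_
          · rw [hdist', hdist', hp]
          · rw [hdist', hdist', hx, ← hy, hq]
        obtain rfl := ih p q (by omega) hpq
        exact (hf p).2.1 hxp.symm hyq.symm hxy
    exact fun x y h => this _ x y rfl h
  · intro z
    -- The range contains `f a` and is closed under adjacency, so a walk from `z` to `f a` can be
    -- lifted.
    obtain ⟨w⟩ := hG.connected.preconnected z (f a)
    generalize hc : f a = c at w
    induction w with
    | nil => exact ⟨a, hc⟩
    | cons h w ih =>
      obtain ⟨x, rfl⟩ := ih hc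
      obtain ⟨y, -, hy⟩ := (hf x).2.2 h.symm
      exact ⟨y, hy⟩

/-- The automorphism group of a regular tree acts transitively on ordered pairs of adjacent
vertices. -/
theorem exists_iso_of_adj [G.LocallyFinite] (hG : G.IsTree) {d : ℕ}
    (hreg : G.IsRegularOfDegree d) {a b a' b' : V} (h : G.Adj a b) (h' : G.Adj a' b') :
    ∃ φ : G ≃g G, φ a = a' ∧ φ b = b' := by
  classical
  -- The root `a` has no parent; letting `b` play that role treats all vertices alike and will force
  -- `b` to go to `b'`.
  have hpar : ∀ x, ∃ p, G.Adj x p ∧ (x = a → p = b) ∧ (x ≠ a → G.dist a x = G.dist a p + 1) := by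
    intro x
    by_cases hx : x = a
    · subst hx; exact ⟨b, h, fun _ => rfl, fun h => absurd rfl h⟩
    · obtain ⟨p, hp⟩ := exists_lower_adj hG hx
      exact ⟨p, hp.1, fun h => absurd h hx, fun _ => hp.2⟩
  choose par hadj hroot hlow using hpar
  have hE : ∀ p x p' x', ∃ f : V → V, G.Adj x p → G.Adj x' p' →
      Set.BijOn f (G.neighborSet x) (G.neighborSet x') ∧ f p = p' := by
    intro p x p' x'
    by_cases h1 : G.Adj x p
    · by_cases h2 : G.Adj x' p'
      · obtain ⟨f, hf⟩ := exists_bijOn_neighborSet hreg h1 h2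
        exact ⟨f, fun _ _ => hf⟩
      · exact ⟨id, fun _ h => absurd h h2⟩
    · exact ⟨id, fun h => absurd h h1⟩
  choose E hE using hE
  -- The second component of `Φ x` is the image of `x`, the first that of its parent; carrying both
  -- makes the recursion on the distance from `a` well posed.
  have hΦ : ∃ Φ : V → V × V, Φ a = (b', a') ∧ ∀ x ≠ a, Φ x =
      ((Φ (par x)).2, E (par (par x)) (par x) (Φ (par x)).1 (Φ (par x)).2 x) := by
    let wf : WellFounded (fun x y => G.dist a x < G.dist a y) := (measure (G.dist a)).wf
    let F : (x : V) → ((y : V) → G.dist a y < G.dist a x → V × V) → V × V := fun x rec =>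
      if hx : x = a then (b', a') else
        have hlt : G.dist a (par x) < G.dist a x := by have := hlow x hx; omega
        ((rec _ hlt).2, E (par (par x)) (par x) (rec _ hlt).1 (rec _ hlt).2 x)
    refine ⟨wf.fix F, ?_, fun x hx => ?_⟩
    · rw [wf.fix_eq]; simp [F]
    · rw [wf.fix_eq]; simp [F, hx]
  obtain ⟨Φ, hΦa, hΦ⟩ := hΦ
  have hΦadj : ∀ n x, G.dist a x = n → G.Adj (Φ x).2 (Φ x).1 := by
    intro n
    induction n with
    | zero =>
      intro x hx
      obtain rfl := hG.connected.dist_eq_zero_iff.mp hx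
      rw [hΦa]; exact h'
    | succ n ih =>
      intro x hx
      have hxa : x ≠ a := by rintro rfl; simp at hx
      have ihp := ih (par x) (by have := hlow x hxa; omega)
      rw [hΦ x hxa]
      exact ((hE (par (par x)) (par x) (Φ (par x)).1 (Φ (par x)).2 (hadj _) ihp).1.1
        (hadj x).symm).symm
  have hloc : ∀ x, Set.EqOn (fun y => (Φ y).2) (E (par x) x (Φ x).1 (Φ x).2)
      (G.neighborSet x) := by
    intro x y hxy
    have hxy : G.Adj x y := hxy
    have child : G.dist a y = G.dist a x + 1 → y ≠ a ∧ par y = x := by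
      intro hd
      have hya : y ≠ a := by rintro rfl; simp at hd
      exact ⟨hya, lower_unique hG (hadj y) (hlow y hya) hxy.symm hd⟩
    rcases hG.dist_eq_dist_add_one_of_adj a hxy with hd | hd
    · have hxa : x ≠ a := by rintro rfl; simp at hd
      obtain rfl : y = par x := lower_unique hG hxy hd (hadj x) (hlow x hxa)
      have := (hE (par x) x (Φ x).1 (Φ x).2 (hadj x) (hΦadj _ x rfl)).2
      simp only [this]
      rw [hΦ x hxa]
    · obtain ⟨hya, rfl⟩ := child hd
      simp only
      rw [hΦ y hya]
  have hbij : ∀ x, Set.BijOn (fun y => (Φ y).2) (G.neighborSet x) (G.neighborSet (Φ x).2) :=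
    fun x => (hE _ _ _ _ (hadj x) (hΦadj _ x rfl)).1.congr (hloc x).symm
  have hB := bijective_of_bijOn_neighborSet hG hbij
  refine ⟨⟨Equiv.ofBijective _ hB, ?_⟩, ?_, ?_⟩
  · intro x y
    simp only [Equiv.ofBijective_apply]
    constructor
    · intro hxy
      obtain ⟨z, hz, hzy⟩ := (hbij x).2.2 hxy
      rwa [← hB.1 hzy]
    · exact fun hxy => (hbij x).1 hxy
  · change (Φ a).2 = a'
    rw [hΦa]
  · change (Φ b).2 = b'
    refine (hloc a h).trans ?_
    rw [hroot a rfl, hΦa]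
    exact (hE _ _ _ _ h h').2

end Transitive

/-! ### The reference product measure and integration over one coordinate. -/

section Reference

open scoped ENNReal

variable {V : Type*}

/-- The product of the Lebesgue measures over all vertices. -/
noncomputable def ref (V : Type*) : Measure (V → unitInterval) :=
  Measure.infinitePi fun _ => (volume : Measure unitInterval)

instance : IsProbabilityMeasure (ref V) := by unfold ref; infer_instance

theorem measurable_comp_pair {ι β : Type*} [MeasurableSpace β]
    {κ : unitInterval → unitInterval → β}
    (hκ : Measurable fun p : unitInterval × unitInterval => κ p.1 p.2) (a b : ι) :
    Measurable fun σ : ι → unitInterval => κ (σ a) (σ b) := by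
  have h : Measurable fun σ : ι → unitInterval => (σ a, σ b) :=
    (measurable_pi_apply a).prodMk (measurable_pi_apply b)
  exact hκ.comp h

theorem measurable_update_prod [DecidableEq V] (y : V) :
    Measurable fun p : (V → unitInterval) × unitInterval => Function.update p.1 y p.2 := by
  refine measurable_pi_lambda _ fun x => ?_
  by_cases h : x = y
  · subst h; simpa using measurable_snd
  · simp only [Function.update_of_ne h]
    exact (measurable_pi_apply x).comp measurable_fst

/-- Resampling one coordinate independently preserves a product measure. This form of Fubini avoids
splitting `V` into `y` and its complement. -/
theorem map_update_ref [DecidableEq V] (y : V) :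
    ((ref V).prod (volume : Measure unitInterval)).map
      (fun p => Function.update p.1 y p.2) = ref V := by
  refine Measure.eq_infinitePi _ fun s t ht => ?_
  rw [Measure.map_apply (measurable_update_prod y)
    (MeasurableSet.pi s.countable_toSet fun i _ => ht i)]
  have hset : (fun p : (V → unitInterval) × unitInterval => Function.update p.1 y p.2) ⁻¹'
      (Set.pi s t) = (Set.pi (s.erase y : Finset V) t) ×ˢ (if y ∈ s then t y else Set.univ) := by
    ext ⟨σ, v⟩
    simp only [Set.mem_preimage, Set.mem_pi, Set.mem_prod, Finset.mem_coe, Finset.mem_erase]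
    constructor
    · intro h
      refine ⟨fun i hi => by simpa [Function.update_of_ne hi.1] using h i hi.2, ?_⟩
      split_ifs with hy
      · simpa using h y hy
      · trivial
    · rintro ⟨h1, h2⟩ i hi
      by_cases hiy : i = y
      · subst hiy; simpa [hi] using h2
      · simpa [Function.update_of_ne hiy] using h1 i ⟨hiy, hi⟩
  rw [hset, Measure.prod_prod, ref, Measure.infinitePi_pi _ fun i _ => ht i]
  split_ifs with hy
  · rw [mul_comm, Finset.mul_prod_erase s (fun i => volume (t i)) hy]
  · rw [Finset.erase_eq_of_notMem hy, measure_univ, mul_one]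

/-- Integrating out one coordinate. -/
theorem lintegral_update [DecidableEq V] (y : V) {F : (V → unitInterval) → ℝ≥0∞}
    (hF : Measurable F) :
    ∫⁻ σ, F σ ∂ref V = ∫⁻ σ, (∫⁻ v, F (Function.update σ y v)) ∂ref V := by
  conv_lhs => rw [← map_update_ref y]
  rw [lintegral_map hF (measurable_update_prod y),
    lintegral_prod (fun p : (V → unitInterval) × unitInterval => F (Function.update p.1 y p.2))
      (hF.comp (measurable_update_prod y)).aemeasurable]

theorem measurePreserving_reindex (φ : V ≃ V) :
    MeasurePreserving (fun (σ : V → unitInterval) x => σ (φ x)) (ref V) (ref V) := by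
  refine ⟨measurable_pi_lambda _ fun x => measurable_pi_apply _, ?_⟩
  refine Measure.eq_infinitePi _ fun s t ht => ?_
  have hm : Measurable fun (σ : V → unitInterval) x => σ (φ x) :=
    measurable_pi_lambda _ fun x => measurable_pi_apply _
  rw [Measure.map_apply hm (MeasurableSet.pi s.countable_toSet fun i _ => ht i)]
  have hset : (fun (σ : V → unitInterval) x => σ (φ x)) ⁻¹' (Set.pi s t) =
      Set.pi (s.map φ.toEmbedding) fun x => t (φ.symm x) := by
    ext σ
    simp only [Set.mem_preimage, Set.mem_pi, Finset.mem_coe, Finset.mem_map_equiv]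
    exact ⟨fun h i hi => by simpa using h _ hi, fun h i hi => by simpa using h (φ i) (by simpa)⟩
  rw [hset, ref, Measure.infinitePi_pi _ fun i _ => ht _, Finset.prod_map]
  simp

end Reference

/-! ### Marginals given by unnormalized weights. -/

section HasWeight

open scoped ENNReal

variable {V : Type*}

/-- The marginal of `μ` on the coordinates in `A` has a density proportional to `w`. -/
def HasWeight (μ : Measure (V → unitInterval)) (A : Finset V)
    (w : (V → unitInterval) → ℝ≥0∞) : Prop :=
  ∃ c : ℝ≥0∞, c ≠ 0 ∧ c ≠ ⊤ ∧ ∀ F : (V → unitInterval) → ℝ≥0∞, Measurable F →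
    DependsOn F A → ∫⁻ σ, F σ ∂μ = c * ∫⁻ σ, F σ * w σ ∂ref V

theorem HasWeight.congr_ae {μ : Measure (V → unitInterval)} {A : Finset V}
    {w w' : (V → unitInterval) → ℝ≥0∞} (h : HasWeight μ A w) {a : ℝ≥0∞} (ha : a ≠ 0)
    (ha' : a ≠ ⊤) (hw' : Measurable w') (hww' : w =ᵐ[ref V] fun σ => a * w' σ) :
    HasWeight μ A w' := by
  obtain ⟨c, hc, hc', H⟩ := h
  refine ⟨c * a, mul_ne_zero hc ha, ENNReal.mul_ne_top hc' ha', fun F hF hFA => ?_⟩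
  rw [H F hF hFA, mul_assoc, ← lintegral_const_mul a (f := fun σ => F σ * w' σ) (hF.mul hw')]
  congr 1
  refine lintegral_congr_ae (hww'.mono fun σ hσ => ?_)
  simp only [hσ]; ring

/-- Testing against the constant 1 shows that both proportionality constants are the inverse of the
total weight. -/
theorem lintegral_eq_of_hasWeight {μ ν : Measure (V → unitInterval)} [IsProbabilityMeasure μ]
    [IsProbabilityMeasure ν] {A : Finset V} {w : (V → unitInterval) → ℝ≥0∞}
    (hμ : HasWeight μ A w) (hν : HasWeight ν A w) {F : (V → unitInterval) → ℝ≥0∞}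
    (hF : Measurable F) (hFA : DependsOn F A) : ∫⁻ σ, F σ ∂μ = ∫⁻ σ, F σ ∂ν := by
  obtain ⟨c, hc, hc', H⟩ := hμ
  obtain ⟨d, hd, hd', K⟩ := hν
  have h1 : 1 = c * ∫⁻ σ, w σ ∂ref V := by
    simpa using H (fun _ => 1) measurable_const (fun _ _ _ => rfl)
  have h2 : 1 = d * ∫⁻ σ, w σ ∂ref V := by
    simpa using K (fun _ => 1) measurable_const (fun _ _ _ => rfl)
  have hcd : c = d := by
    rw [ENNReal.eq_inv_of_mul_eq_one_left h1.symm, ENNReal.eq_inv_of_mul_eq_one_left h2.symm]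
  rw [H F hF hFA, K F hF hFA, hcd]

theorem lintegral_eq_of_map_restrict_eq {μ ν : Measure (V → unitInterval)} {A : Finset V}
    (h : μ.map A.restrict = ν.map A.restrict) {F : (V → unitInterval) → ℝ≥0∞}
    (hF : Measurable F) (hFA : DependsOn F A) : ∫⁻ σ, F σ ∂μ = ∫⁻ σ, F σ ∂ν := by
  classical
  let ext : (A → unitInterval) → V → unitInterval :=
    fun τ x => if hx : x ∈ A then τ ⟨x, hx⟩ else 0
  have hext : Measurable ext := by
    refine measurable_pi_lambda _ fun x => ?_
    by_cases hx : x ∈ A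
    · simpa [ext, hx] using measurable_pi_apply _
    · simp [ext, hx]
  have key : ∀ ρ : Measure (V → unitInterval),
      ∫⁻ σ, F σ ∂ρ = ∫⁻ τ, F (ext τ) ∂(ρ.map A.restrict) := by
    intro ρ
    rw [lintegral_map (f := fun τ => F (ext τ)) (hF.comp hext) (Finset.measurable_restrict A)]
    refine lintegral_congr fun σ => hFA fun x hx => ?_
    have hx : x ∈ A := hx
    simp [ext, hx]
  rw [key, key, h]

theorem map_restrict_eq_of_lintegral_eq {μ ν : Measure (V → unitInterval)} {A : Finset V}
    (h : ∀ F : (V → unitInterval) → ℝ≥0∞, Measurable F → DependsOn F A →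
      ∫⁻ σ, F σ ∂μ = ∫⁻ σ, F σ ∂ν) : μ.map A.restrict = ν.map A.restrict := by
  ext S hS
  rw [← lintegral_indicator_one hS, ← lintegral_indicator_one hS,
    lintegral_map (measurable_one.indicator hS) (Finset.measurable_restrict A),
    lintegral_map (measurable_one.indicator hS) (Finset.measurable_restrict A)]
  refine h (fun σ => S.indicator 1 (A.restrict σ))
    ((measurable_one.indicator hS).comp (Finset.measurable_restrict A)) ?_
  intro σ τ hστ
  have : A.restrict σ = A.restrict τ := by ext ⟨i, hi⟩; exact congrArg _ (hστ i hi)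
  simp only [this]

theorem eq_of_lintegral_eq {μ ν : Measure (V → unitInterval)} [IsProbabilityMeasure μ]
    (h : ∀ (J : Finset V) (F : (V → unitInterval) → ℝ≥0∞), Measurable F → DependsOn F J →
      ∫⁻ σ, F σ ∂μ = ∫⁻ σ, F σ ∂ν) : μ = ν := by
  have hμ : IsProjectiveLimit μ fun J : Finset V => μ.map J.restrict := fun J => rfl
  have hν : IsProjectiveLimit ν fun J : Finset V => μ.map J.restrict := fun J =>
    (map_restrict_eq_of_lintegral_eq (h J)).symm
  have : ∀ J : Finset V, IsFiniteMeasure (μ.map J.restrict) := fun J => inferInstance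
  exact hμ.unique hν

theorem eq_of_hasWeight_ball {G : SimpleGraph V} [G.LocallyFinite] (hG : G.IsTree) {r : V}
    {μ ν : Measure (V → unitInterval)} [IsProbabilityMeasure μ] [IsProbabilityMeasure ν]
    {w : ℕ → (V → unitInterval) → ℝ≥0∞} (hμ : ∀ m, 1 ≤ m → HasWeight μ (ball G r m) (w m))
    (hν : ∀ m, 1 ≤ m → HasWeight ν (ball G r m) (w m)) : μ = ν := by
  refine eq_of_lintegral_eq fun J F hF hFJ => ?_
  -- The `+ 1` keeps the radius at least 1, since nothing is assumed about radius 0.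
  have hsub : J ⊆ ball G r (J.sup (G.dist r) + 1) := fun x hx => by
    rw [mem_ball hG]
    exact (Finset.le_sup (f := G.dist r) hx).trans (Nat.le_succ _)
  exact lintegral_eq_of_hasWeight (hμ _ (Nat.succ_le_succ (Nat.zero_le _)))
    (hν _ (Nat.succ_le_succ (Nat.zero_le _))) hF (hFJ.mono (by exact_mod_cast hsub))

/-- Integrating out a vertex whose interaction factors through one neighbour. -/
theorem lintegral_pendant [DecidableEq V] {κ : unitInterval → unitInterval → ℝ≥0∞}
    (hκ : Measurable fun p : unitInterval × unitInterval => κ p.1 p.2) {q : unitInterval → ℝ≥0∞}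
    (hq : Measurable q) {x y : V} (hxy : x ≠ y) {R : (V → unitInterval) → ℝ≥0∞} (hR : Measurable R)
    (hRy : ∀ σ v, R (Function.update σ y v) = R σ) :
    ∫⁻ σ, R σ * (κ (σ x) (σ y) * q (σ y)) ∂ref V =
      ∫⁻ σ, R σ * (∫⁻ v, κ (σ x) v * q v) ∂ref V := by
  have hm : Measurable fun σ : V → unitInterval => κ (σ x) (σ y) :=
    measurable_comp_pair hκ x y
  rw [lintegral_update y (F := fun σ => R σ * (κ (σ x) (σ y) * q (σ y))) (hR.mul (hm.mul (hq.comp (measurable_pi_apply y))))]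
  refine lintegral_congr fun σ => ?_
  simp only [hRy, Function.update_self, Function.update_of_ne hxy]
  refine lintegral_const_mul _ (Measurable.mul ?_ hq)
  exact hκ.comp (measurable_const.prodMk measurable_id)

theorem lintegral_eval_mul [DecidableEq V] {q : unitInterval → ℝ≥0∞} (hq : Measurable q) {y : V}
    {R : (V → unitInterval) → ℝ≥0∞} (hR : Measurable R)
    (hRy : ∀ σ v, R (Function.update σ y v) = R σ) :
    ∫⁻ σ, q (σ y) * R σ ∂ref V = (∫⁻ v, q v) * ∫⁻ σ, R σ ∂ref V := by
  rw [lintegral_update y (F := fun σ => q (σ y) * R σ) ((hq.comp (measurable_pi_apply y)).mul hR), ← lintegral_const_mul _ hR]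
  refine lintegral_congr fun σ => ?_
  simp only [hRy, Function.update_self]
  exact lintegral_mul_const _ hq

theorem update_eq_of_dependsOn [DecidableEq V] {β : Type*} {F : (V → unitInterval) → β} {A : Set V}
    (hF : DependsOn F A) {y : V} (hy : y ∉ A) (σ : V → unitInterval) (v : unitInterval) :
    F (Function.update σ y v) = F σ :=
  hF fun i hi => Function.update_of_ne (by rintro rfl; exact hy hi) _ _

end HasWeight

/-! ### Products of edge interactions. -/

section EdgeWeight

open scoped ENNReal

variable {V : Type*} {G : SimpleGraph V} {κ : Sym2 unitInterval → ℝ≥0∞}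

/-- The product of the edge interactions over the edges inside `A`. -/
noncomputable def edgeWeight (G : SimpleGraph V) (κ : Sym2 unitInterval → ℝ≥0∞) (A : Finset V)
    (σ : V → unitInterval) : ℝ≥0∞ := ∏ e ∈ edgesIn G A, κ (e.map σ)

theorem measurable_edgeWeight
    (hκ : Measurable fun p : unitInterval × unitInterval => κ s(p.1, p.2)) (A : Finset V) :
    Measurable (edgeWeight G κ A) := by
  refine Finset.measurable_prod _ fun e _ => ?_
  induction e with | _ a b
  exact measurable_comp_pair (κ := fun u v => κ s(u, v)) hκ a b

theorem dependsOn_edgeWeight (A : Finset V) : DependsOn (edgeWeight G κ A) A := by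
  intro σ τ h
  refine Finset.prod_congr rfl fun e he => ?_
  induction e with | _ a b
  rw [mem_edgesIn] at he
  simp only [Sym2.map_mk, h a he.1, h b he.2.1]

theorem edgeWeight_insert [DecidableEq V] {A : Finset V} {x y : V} (hy : y ∉ A) (hx : x ∈ A)
    (hxy : G.Adj x y) (hu : ∀ z ∈ A, G.Adj y z → z = x) (σ : V → unitInterval) :
    edgeWeight G κ (insert y A) σ = κ s(σ x, σ y) * edgeWeight G κ A σ := by
  classical
  rw [edgeWeight, edgesIn_insert hx hxy hu, Finset.prod_insert (notMem_edgesIn hy)]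
  rfl

theorem edgeWeight_map (φ : G ≃g G) (A : Finset V) (σ : V → unitInterval) :
    edgeWeight G κ (A.map φ.toEquiv.toEmbedding) σ = edgeWeight G κ A fun x => σ (φ x) := by
  rw [edgeWeight, edgesIn_map, Finset.prod_map]
  refine Finset.prod_congr rfl fun e _ => ?_
  induction e with | _ a b
  rfl

end EdgeWeight

/-! ### Splitting Gibbs measures in terms of weights on full configurations. -/

section SplittingGibbs

open scoped ENNReal

variable {V : Type*} {G : SimpleGraph V} [G.LocallyFinite]

open Classical in
/-- The sphere of radius `m` around `r`. -/
noncomputable def sphere (G : SimpleGraph V) [G.LocallyFinite] (r : V) (m : ℕ) : Finset V :=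
  (ball G r m).filter fun x => G.dist r x = m

theorem mem_sphere (hG : G.IsTree) {r : V} {m : ℕ} {x : V} :
    x ∈ sphere G r m ↔ G.dist r x = m := by
  rw [sphere, Finset.mem_filter, mem_ball hG, and_iff_right_iff_imp]
  exact fun h => h.le

/-- The interaction on the ball of radius `m` with boundary factors `q` on the sphere. -/
noncomputable def ballWeight (G : SimpleGraph V) [G.LocallyFinite] (κ : Sym2 unitInterval → ℝ≥0∞)
    (r : V) (q : V → unitInterval → ℝ≥0∞) (m : ℕ) (σ : V → unitInterval) : ℝ≥0∞ :=
  edgeWeight G κ (ball G r m) σ * ∏ x ∈ sphere G r m, q x (σ x)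

open Classical in
theorem sum_induce_edgeFinset (ξ : Sym2 unitInterval → ℝ) (r : V) (m : ℕ) (σ : V → unitInterval) :
    ∑ e ∈ (G.induce (disk G r m)).edgeFinset, ξ (e.map ((disk G r m).domRestrict σ)) =
      ∑ e ∈ edgesIn G (ball G r m), ξ (e.map σ) := by
  refine Finset.sum_bij (fun e _ => e.map Subtype.val) ?_ ?_ ?_ ?_
  · intro e he
    induction e with | _ a b
    rw [SimpleGraph.mem_edgeFinset, SimpleGraph.mem_edgeSet] at he
    refine mem_edgesIn.mpr ⟨?_, ?_, he⟩
    · rw [← Finset.mem_coe, coe_ball]; exact a.2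
    · rw [← Finset.mem_coe, coe_ball]; exact b.2
  · intro e _ e' _ h
    exact Sym2.map.injective Subtype.val_injective h
  · intro e he
    induction e with | _ a b
    obtain ⟨ha, hb, hab⟩ := mem_edgesIn.mp he
    rw [← Finset.mem_coe, coe_ball] at ha hb
    exact ⟨s(⟨a, ha⟩, ⟨b, hb⟩), by
      rw [SimpleGraph.mem_edgeFinset, SimpleGraph.mem_edgeSet]; exact hab, rfl⟩
  · intro e _
    rw [Sym2.map_map]
    rfl

open Classical in
theorem density_eq_ballWeight (hG : G.IsTree) (ξ : Sym2 unitInterval → ℝ) (r : V)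
    (h : V → unitInterval → ℝ) (m : ℕ) (σ : V → unitInterval) :
    ENNReal.ofReal (Real.exp (-1 * hamiltonian G ξ r m ((disk G r m).domRestrict σ) +
      ∑ x ∈ Finset.univ.filter (fun x : disk G r m => G.edist r (x : V) = m),
        h x ((disk G r m).domRestrict σ x))) =
    ballWeight G (fun e => ENNReal.ofReal (Real.exp (ξ e))) r
      (fun x u => ENNReal.ofReal (Real.exp (h x u))) m σ := by
  have h2 : ∑ x ∈ Finset.univ.filter (fun x : disk G r m => G.edist r (x : V) = m),
      h x ((disk G r m).domRestrict σ x) = ∑ x ∈ sphere G r m, h x (σ x) := by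
    refine Finset.sum_bij (fun x _ => (x : V)) ?_ (fun _ _ _ _ => Subtype.ext) ?_ fun _ _ => rfl
    · intro x hx
      have := (Finset.mem_filter.mp hx).2
      rw [← (hG.connected.preconnected r x).coe_dist_eq_edist] at this
      exact (mem_sphere hG).mpr (by exact_mod_cast this)
    · intro x hx
      have hx' := (mem_sphere hG).mp hx
      have hxd : x ∈ disk G r m := by
        rw [← coe_ball, Finset.mem_coe, mem_ball hG, hx']
      refine ⟨⟨x, hxd⟩, Finset.mem_filter.mpr ⟨Finset.mem_univ _, ?_⟩, rfl⟩
      rw [← (hG.connected.preconnected r x).coe_dist_eq_edist, hx']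
  rw [h2, hamiltonian, sum_induce_edgeFinset, neg_one_mul, neg_neg, Real.exp_add, Real.exp_sum,
    Real.exp_sum, ENNReal.ofReal_mul (Finset.prod_nonneg fun _ _ => (Real.exp_pos _).le),
    ENNReal.ofReal_prod_of_nonneg fun _ _ => (Real.exp_pos _).le,
    ENNReal.ofReal_prod_of_nonneg fun _ _ => (Real.exp_pos _).le]
  rfl

theorem lintegral_weightMeasure (hG : G.IsTree) {ξ : Sym2 unitInterval → ℝ}
    (hξ : Measurable fun p : unitInterval × unitInterval => ξ s(p.1, p.2)) (r : V)
    {h : V → unitInterval → ℝ} (hh : ∀ x, Measurable (h x)) (m : ℕ)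
    {F : (disk G r m → unitInterval) → ℝ≥0∞} (hF : Measurable F) :
    ∫⁻ τ, F τ ∂weightMeasure G ξ 1 r h m =
      ∫⁻ σ, F ((disk G r m).domRestrict σ) *
        ballWeight G (fun e => ENNReal.ofReal (Real.exp (ξ e))) r
          (fun x u => ENNReal.ofReal (Real.exp (h x u))) m σ ∂ref V := by
  have hr : Measurable ((disk G r m).domRestrict (π := fun _ => unitInterval)) :=
    measurable_pi_lambda _ fun x => measurable_pi_apply _
  have hham : Measurable (hamiltonian G ξ r m) := by
    unfold hamiltonian
    refine (Finset.measurable_sum _ fun e _ => ?_).neg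
    induction e with | _ a b
    exact measurable_comp_pair (κ := fun u v => ξ s(u, v)) hξ a b
  have hmap : (ref V).map (disk G r m).domRestrict =
      Measure.pi fun _ : disk G r m => (volume : Measure unitInterval) := by
    rw [ref, Measure.infinitePi_map_restrict', Measure.infinitePi_eq_pi]
  have hdens : Measurable fun τ : disk G r m → unitInterval =>
      ENNReal.ofReal (Real.exp (-1 * hamiltonian G ξ r m τ +
        ∑ x ∈ Finset.univ.filter (fun x : disk G r m => G.edist r (x : V) = m), h x (τ x))) := by
    refine (Real.measurable_exp.comp ((hham.const_mul _).add
      (Finset.measurable_sum _ fun x _ => ?_))).ennreal_ofReal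
    exact (hh x).comp (measurable_pi_apply x)
  rw [weightMeasure, lintegral_withDensity_eq_lintegral_mul _ ?_ hF, ← hmap,
    lintegral_map (Measurable.mul ?_ hF) hr]
  · refine lintegral_congr fun σ => ?_
    rw [← density_eq_ballWeight hG, Pi.mul_apply, mul_comm]
  · convert hdens
  · convert hdens

/-- Moves everything from the disks to the single space of full configurations and hides the
normalizations in the constant of `HasWeight`. -/
theorem isSplittingGibbs_iff (hG : G.IsTree) {ξ : Sym2 unitInterval → ℝ}
    (hξ : Measurable fun p : unitInterval × unitInterval => ξ s(p.1, p.2)) (r : V)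
    {μ : Measure (V → unitInterval)} :
    IsSplittingGibbs G ξ 1 r μ ↔ IsProbabilityMeasure μ ∧ ∃ h : V → unitInterval → ℝ,
      (∀ x, Measurable (h x)) ∧ ∀ m : ℕ, 1 ≤ m → HasWeight μ (ball G r m)
        (ballWeight G (fun e => ENNReal.ofReal (Real.exp (ξ e))) r
          (fun x u => ENNReal.ofReal (Real.exp (h x u))) m) := by
  classical
  refine and_congr_right fun hμ => exists_congr fun h => and_congr_right fun hh =>
    forall_congr' fun m => imp_congr_right fun _ => ?_
  have hr : Measurable ((disk G r m).domRestrict (π := fun _ => unitInterval)) :=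
    measurable_pi_lambda _ fun x => measurable_pi_apply _
  have hW := fun F hF => lintegral_weightMeasure hG hξ r hh m (F := F) hF
  constructor
  · intro hμm
    set W := weightMeasure G ξ 1 r h m with hWdef
    -- A zero or infinite partition function would make this product 0, so total mass 1 excludes
    -- both.
    have hmass : (W Set.univ)⁻¹ * W Set.univ = 1 := by
      have h1 : μ.map (disk G r m).domRestrict Set.univ = 1 := by
        rw [Measure.map_apply hr MeasurableSet.univ]; simp
      rw [hμm] at h1
      simpa [finiteVolumeMeasure] using h1
    have hne : (W Set.univ)⁻¹ ≠ 0 := by rintro h0; simp [h0] at hmass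
    have hne' : W Set.univ ≠ 0 := by rintro h0; simp [h0] at hmass
    refine ⟨(W Set.univ)⁻¹, hne, ENNReal.inv_ne_top.mpr hne', fun F hF hFA => ?_⟩
    let ext : (disk G r m → unitInterval) → V → unitInterval :=
      fun τ x => if hx : x ∈ disk G r m then τ ⟨x, hx⟩ else 0
    have hext : Measurable ext := by
      refine measurable_pi_lambda _ fun x => ?_
      by_cases hx : x ∈ disk G r m
      · simpa [ext, hx] using measurable_pi_apply _
      · simp [ext, hx]
    have hFext : ∀ σ, F (ext ((disk G r m).domRestrict σ)) = F σ := by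
      intro σ
      refine hFA fun x hx => ?_
      rw [coe_ball] at hx
      simp [ext, hx]
    have e1 : ∫⁻ σ, F σ ∂μ = ∫⁻ τ, F (ext τ) ∂(μ.map (disk G r m).domRestrict) := by
      rw [lintegral_map (f := fun τ => F (ext τ)) (hF.comp hext) hr]
      simp only [hFext]
    rw [e1, hμm, finiteVolumeMeasure, lintegral_smul_measure, hW (fun τ => F (ext τ)) (hF.comp hext),
      smul_eq_mul]
    simp only [hFext]
    rfl
  · rintro ⟨c, hc, hc', H⟩
    have key : ∀ S, MeasurableSet S → μ.map (disk G r m).domRestrict S =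
        c * weightMeasure G ξ 1 r h m S := by
      intro S hS
      rw [← lintegral_indicator_one hS, ← lintegral_indicator_one hS,
        lintegral_map (measurable_one.indicator hS) hr, hW _ (measurable_one.indicator hS)]
      refine H (fun σ => S.indicator 1 ((disk G r m).domRestrict σ))
        ((measurable_one.indicator hS).comp hr) fun σ τ hστ => ?_
      have : (disk G r m).domRestrict σ = (disk G r m).domRestrict τ := by
        ext ⟨i, hi⟩
        rw [← coe_ball] at hi
        exact congrArg _ (hστ i hi)
      simp only [this]
    have hu := key Set.univ MeasurableSet.univ
    rw [Measure.map_apply hr MeasurableSet.univ, Set.preimage_univ, measure_univ] at hu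
    ext S hS
    rw [key S hS, finiteVolumeMeasure, Measure.smul_apply, smul_eq_mul,
      ENNReal.eq_inv_of_mul_eq_one_left hu.symm]

end SplittingGibbs

/-! ### Factorization of the interaction and moments of the spin. -/

section Spin

theorem eq_oddRoot_of_pow_eq {n : ℕ} {x y : ℝ} (h : y ^ (2 * n + 1) = x) : y = oddRoot n x :=
  (Odd.strictMono_pow (odd_two_mul_add_one n)).injective (h.trans (oddRoot_pow n x).symm)

theorem oddRoot_mul (n : ℕ) (x y : ℝ) : oddRoot n (x * y) = oddRoot n x * oddRoot n y :=
  (eq_oddRoot_of_pow_eq (by rw [mul_pow, oddRoot_pow, oddRoot_pow])).symm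

theorem oddRoot_neg (n : ℕ) (x : ℝ) : oddRoot n (-x) = -oddRoot n x :=
  (eq_oddRoot_of_pow_eq (by rw [(odd_two_mul_add_one n).neg_pow, oddRoot_pow])).symm

theorem monotone_oddRoot (n : ℕ) : Monotone (oddRoot n) := by
  intro x y h
  rwa [← (Odd.strictMono_pow (odd_two_mul_add_one n)).le_iff_le, oddRoot_pow, oddRoot_pow]

theorem oddRoot_of_nonneg (n : ℕ) {x : ℝ} (hx : 0 ≤ x) :
    oddRoot n x = x ^ (1 / (2 * (n : ℝ) + 1)) := by
  refine (eq_oddRoot_of_pow_eq ?_).symm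
  rw [one_div, show (2 * (n : ℝ) + 1) = ((2 * n + 1 : ℕ) : ℝ) by push_cast; ring]
  exact Real.rpow_inv_natCast_pow hx (by omega)

/-- The odd root of `2u - 1`, in terms of which the interaction factorizes. -/
noncomputable def spin (n : ℕ) (u : unitInterval) : ℝ := oddRoot n (2 * (u : ℝ) - 1)

theorem measurable_spin (n : ℕ) : Measurable (spin n) :=
  (monotone_oddRoot n).measurable.comp ((measurable_subtype_coe.const_mul 2).sub_const 1)

theorem abs_spin_le (n : ℕ) (u : unitInterval) : |spin n u| ≤ 1 := by
  refine le_of_not_gt fun h => ?_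
  have h1 : 1 < |spin n u| ^ (2 * n + 1) := one_lt_pow₀ h (by omega)
  rw [← abs_pow, spin, oddRoot_pow] at h1
  refine absurd h1 (not_lt.mpr (abs_le.mpr ⟨?_, ?_⟩)) <;> linarith [u.2.1, u.2.2]

/-- This factorization makes the model solvable: the transfer operator has rank at most two. -/
theorem oddRoot_eq_spin_mul (n : ℕ) (u v : unitInterval) :
    oddRoot n (4 * ((u : ℝ) - 1 / 2) * ((v : ℝ) - 1 / 2)) = spin n u * spin n v := by
  rw [spin, spin, ← oddRoot_mul]
  congr 1
  ring

theorem one_add_mul_pos {a b : ℝ} (ha : |a| < 1) (hb : |b| ≤ 1) : 0 < 1 + a * b := by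
  have : |a * b| < 1 := by
    rw [abs_mul]
    calc |a| * |b| ≤ |a| * 1 := by gcongr
      _ < 1 := by rwa [mul_one]
  linarith [(abs_lt.mp this).1]

theorem exp_potential (n : ℕ) {θ : ℝ} (hθ : |θ| < 1) (u v : unitInterval) :
    Real.exp (potential n θ s(u, v)) = 1 + θ * (spin n u * spin n v) := by
  change Real.exp (Real.log (1 + θ * oddRoot n _)) = _
  rw [oddRoot_eq_spin_mul]
  refine Real.exp_log (one_add_mul_pos hθ ?_)
  rw [abs_mul]
  exact mul_le_one₀ (abs_spin_le n u) (abs_nonneg _) (abs_spin_le n v)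

theorem measurable_potential (n : ℕ) (θ : ℝ) :
    Measurable fun p : unitInterval × unitInterval => potential n θ s(p.1, p.2) := by
  change Measurable fun p : unitInterval × unitInterval =>
    Real.log (1 + θ * oddRoot n (4 * ((p.1 : ℝ) - 1 / 2) * ((p.2 : ℝ) - 1 / 2)))
  simp only [oddRoot_eq_spin_mul]
  exact Real.measurable_log.comp ((((measurable_spin n).comp measurable_fst).mul
    ((measurable_spin n).comp measurable_snd)).const_mul θ |>.const_add 1)

theorem integral_oddRoot_pow (n j : ℕ) :
    ∫ x in (0 : ℝ)..1, oddRoot n x ^ j = (2 * n + 1) / (j + (2 * n + 1)) := by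
  have h : ∀ x ∈ Set.uIcc (0 : ℝ) 1, oddRoot n x ^ j = x ^ ((j : ℝ) / (2 * n + 1)) := by
    intro x hx
    rw [Set.uIcc_of_le zero_le_one] at hx
    rw [oddRoot_of_nonneg n hx.1, ← Real.rpow_mul_natCast hx.1]
    congr 1
    ring
  have hp : (0 : ℝ) ≤ (j : ℝ) / (2 * n + 1) := by positivity
  rw [intervalIntegral.integral_congr h, integral_rpow (Or.inl (by linarith)), Real.one_rpow,
    Real.zero_rpow (by positivity)]
  field_simp
  ring

/-- The moments of `spin`. -/
noncomputable def moment (n j : ℕ) : ℝ :=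
  if Even j then (2 * n + 1) / (j + (2 * n + 1)) else 0

theorem integral_spin_pow (n j : ℕ) : ∫ u, spin n u ^ j = moment n j := by
  have hmono : ∀ a b : ℝ, IntervalIntegrable (fun x => oddRoot n x ^ j) volume a b := by
    intro a b
    have hb : ∀ x ∈ Set.uIcc a b, |oddRoot n x ^ j| ≤
        (|oddRoot n (min a b)| + |oddRoot n (max a b)|) ^ j := by
      intro x hx
      rw [abs_pow]
      refine pow_le_pow_left₀ (abs_nonneg _) (abs_le.mpr ⟨?_, ?_⟩) _
      · have := monotone_oddRoot n hx.1
        have := neg_abs_le (oddRoot n (min a b))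
        have := abs_nonneg (oddRoot n (max a b))
        linarith
      · have := monotone_oddRoot n hx.2
        have := le_abs_self (oddRoot n (max a b))
        have := abs_nonneg (oddRoot n (min a b))
        linarith
    refine (intervalIntegrable_const (c := (|oddRoot n (min a b)| + |oddRoot n (max a b)|) ^ j)
      (μ := volume)).mono_fun
      ((monotone_oddRoot n).measurable.pow_const j).aestronglyMeasurable ?_
    refine (ae_restrict_mem measurableSet_uIoc).mono fun x hx => ?_
    exact (hb x (Set.uIoc_subset_uIcc hx)).trans (le_abs_self _)
  have h1 : ∫ u, spin n u ^ j = ∫ x in (0 : ℝ)..1, oddRoot n (2 * x - 1) ^ j := by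
    rw [intervalIntegral.integral_of_le zero_le_one, ← integral_Icc_eq_integral_Ioc]
    exact integral_subtype_comap measurableSet_Icc fun x : ℝ => oddRoot n (2 * x - 1) ^ j
  -- After the substitution x = 2u - 1 the integral runs over [-1, 1], and oddness of the root
  -- decides whether the two halves add or cancel.
  have h2 : ∫ x in (-1 : ℝ)..0, oddRoot n x ^ j = (-1) ^ j * ∫ x in (0 : ℝ)..1, oddRoot n x ^ j := by
    have := intervalIntegral.integral_comp_neg (a := 0) (b := 1) fun x : ℝ => oddRoot n x ^ j
    rw [neg_zero] at this
    rw [← this, ← intervalIntegral.integral_const_mul]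
    refine intervalIntegral.integral_congr fun x _ => ?_
    simp only [oddRoot_neg]
    rw [neg_pow]
  rw [h1, intervalIntegral.integral_comp_mul_sub (fun x => oddRoot n x ^ j) two_ne_zero]
  norm_num
  rw [← intervalIntegral.integral_add_adjacent_intervals (hmono (-1) 0) (hmono 0 1), h2,
    integral_oddRoot_pow, moment]
  split_ifs with hj
  · rw [hj.neg_one_pow]; ring
  · rw [(Nat.not_even_iff_odd.mp hj).neg_one_pow]; ring

end Spin

/-! ### The self-consistency equation and the number of its solutions. -/

section FixedPoint

theorem integrable_of_bound {f : unitInterval → ℝ} (hf : Measurable f) {C : ℝ}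
    (h : ∀ u, |f u| ≤ C) : Integrable f :=
  Integrable.of_bound hf.aestronglyMeasurable C (ae_of_all _ h)

theorem integrable_spin_pow (n j : ℕ) : Integrable fun u => spin n u ^ j :=
  integrable_of_bound ((measurable_spin n).pow_const j) (C := 1) fun u => by
    rw [abs_pow]; exact pow_le_one₀ (abs_nonneg _) (abs_spin_le n u)

theorem integral_spin_pow_mul (n k l : ℕ) (s : ℝ) :
    ∫ u, spin n u ^ l * (1 + s * spin n u) ^ k =
      ∑ i ∈ Finset.range (k + 1), k.choose i * moment n (i + l) * s ^ i := by
  have h : ∀ u, spin n u ^ l * (1 + s * spin n u) ^ k =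
      ∑ i ∈ Finset.range (k + 1), (k.choose i * s ^ i) * spin n u ^ (i + l) := by
    intro u
    rw [add_comm 1, add_pow, Finset.mul_sum]
    refine Finset.sum_congr rfl fun i _ => ?_
    rw [one_pow, mul_pow, pow_add]
    ring
  simp only [h]
  rw [integral_finsetSum _ fun i _ => (integrable_spin_pow n (i + l)).const_mul _]
  refine Finset.sum_congr rfl fun i _ => ?_
  rw [integral_const_mul, integral_spin_pow]
  ring

/-- The self-consistency equation for the boundary weights `(1 + s * spin) ^ k`. -/
def IsFixed (n k : ℕ) (θ s : ℝ) : Prop :=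
  s * ∫ u, (1 + s * spin n u) ^ k = θ * ∫ u, spin n u * (1 + s * spin n u) ^ k

/-- The coefficients of the polynomial whose zeros are the nonzero solutions. -/
noncomputable def fixedCoeff (n k : ℕ) (θ : ℝ) (i : ℕ) : ℝ :=
  k.choose i * moment n i - θ * (k.choose (i + 1) * moment n (i + 2))

theorem moment_odd (n : ℕ) {j : ℕ} (hj : Odd j) : moment n j = 0 :=
  if_neg (Nat.not_even_iff_odd.mpr hj)

/-- The first moment of the spin vanishes, so the second integral has no constant term in `s` and a
factor `s` splits off. -/
theorem fixed_sub_eq (n k : ℕ) (θ s : ℝ) :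
    s * (∫ u, (1 + s * spin n u) ^ k) - θ * (∫ u, spin n u * (1 + s * spin n u) ^ k) =
      s * ∑ i ∈ Finset.range (k + 1), fixedCoeff n k θ i * s ^ i := by
  have h0 := integral_spin_pow_mul n k 0 s
  have h1 := integral_spin_pow_mul n k 1 s
  simp only [pow_zero, one_mul, add_zero, pow_one] at h0 h1
  have h2 : ∑ i ∈ Finset.range (k + 1), k.choose i * moment n (i + 1) * s ^ i =
      s * ∑ i ∈ Finset.range (k + 1), k.choose (i + 1) * moment n (i + 2) * s ^ i := by
    -- The term dropped on the left carries the first moment, the one on the right carries `k.choose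
    -- (k + 1)`; both are zero.
    rw [Finset.sum_range_succ', Finset.sum_range_succ _ k, Nat.choose_succ_self,
      moment_odd n (j := 0 + 1) (by decide), mul_add, Finset.mul_sum]
    simp only [Nat.cast_zero, zero_mul, mul_zero, add_zero]
    refine Finset.sum_congr rfl fun i _ => ?_
    rw [show i + 1 + 1 = i + 2 by rfl]
    ring
  rw [h0, h1, h2, ← mul_assoc, mul_comm θ s, mul_assoc, ← mul_sub, Finset.mul_sum _ _ θ,
    ← Finset.sum_sub_distrib]
  congr 1
  refine Finset.sum_congr rfl fun i _ => ?_
  rw [fixedCoeff]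
  ring

/-- The sign of the coefficients of even index. -/
noncomputable def coeffSign (n k : ℕ) (θ : ℝ) (i : ℕ) : ℝ :=
  (i + 1) * (i + 2 + (2 * n + 1)) - θ * ((k - i) * (i + (2 * n + 1)))

theorem fixedCoeff_odd {n k : ℕ} {θ : ℝ} {i : ℕ} (hi : Odd i) : fixedCoeff n k θ i = 0 := by
  rw [fixedCoeff, moment_odd n hi, moment_odd n (hi.add_even even_two)]
  ring

theorem fixedCoeff_even {n k : ℕ} {θ : ℝ} {i : ℕ} (hi : Even i) (hik : i ≤ k) :
    fixedCoeff n k θ i = k.choose i * (2 * n + 1) /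
      ((i + (2 * n + 1)) * (i + 1) * (i + 2 + (2 * n + 1))) * coeffSign n k θ i := by
  have hc : (k.choose (i + 1) : ℝ) * (i + 1) = k.choose i * (k - i) := by
    rw [← Nat.cast_sub hik]
    exact_mod_cast Nat.choose_succ_right_eq k i
  have hc' : (k.choose (i + 1) : ℝ) = k.choose i * (k - i) / (i + 1) := by
    rw [eq_div_iff (by positivity), hc]
  rw [fixedCoeff, moment, moment, if_pos hi, if_pos (hi.add even_two), coeffSign, hc']
  push_cast
  field_simp

/-- Divided by x = i + 2n + 1, the first product is x - 4n/x plus a constant, which increases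
strictly, while θ(k - i) does not increase. Hence the signs change at most once. -/
theorem coeffSign_pos {n k : ℕ} {θ : ℝ} (hθ : 0 ≤ θ) {i j : ℕ} (hij : i < j)
    (hi : 0 ≤ coeffSign n k θ i) : 0 < coeffSign n k θ j := by
  have hij' : (i : ℝ) < j := by exact_mod_cast hij
  rw [coeffSign] at hi ⊢
  have hn : (0 : ℝ) ≤ n := n.cast_nonneg
  have hi0 : (0 : ℝ) ≤ i := i.cast_nonneg
  have h1 : θ * ((k - j) * (j + (2 * n + 1))) * (i + (2 * n + 1)) ≤
      (i + 1) * (i + 2 + (2 * n + 1)) * (j + (2 * (n : ℝ) + 1)) := by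
    have : θ * (k - j) ≤ θ * ((k : ℝ) - i) := by gcongr
    calc θ * ((k - j) * (j + (2 * n + 1))) * (i + (2 * n + 1))
        = θ * (k - j) * ((j + (2 * n + 1)) * (i + (2 * n + 1))) := by ring
      _ ≤ θ * (k - i) * ((j + (2 * n + 1)) * (i + (2 * n + 1))) := by gcongr
      _ = θ * ((k - i) * (i + (2 * n + 1))) * (j + (2 * n + 1)) := by ring
      _ ≤ (i + 1) * (i + 2 + (2 * n + 1)) * (j + (2 * (n : ℝ) + 1)) := by
        exact mul_le_mul_of_nonneg_right (by linarith) (by positivity)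
  have h2 : ((i : ℝ) + 1) * (i + 2 + (2 * n + 1)) * (j + (2 * n + 1)) <
      (j + 1) * (j + 2 + (2 * n + 1)) * (i + (2 * n + 1)) := by
    have : ((j : ℝ) + 1) * (j + 2 + (2 * n + 1)) * (i + (2 * n + 1)) -
        (i + 1) * (i + 2 + (2 * n + 1)) * (j + (2 * n + 1)) =
        (j - i) * ((i + (2 * n + 1)) * (j + (2 * n + 1)) + 4 * n) := by ring
    have : 0 < ((j : ℝ) - i) * ((i + (2 * n + 1)) * (j + (2 * n + 1)) + 4 * n) :=
      mul_pos (by linarith) (by positivity)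
    linarith
  have h3 := h1.trans_lt h2
  have := lt_of_mul_lt_mul_right h3 (by positivity)
  linarith

theorem factor_pos {n k i : ℕ} (hik : i ≤ k) : (0 : ℝ) < k.choose i * (2 * n + 1) /
    ((i + (2 * n + 1)) * (i + 1) * (i + 2 + (2 * n + 1))) := by
  have : (0 : ℝ) < k.choose i := by exact_mod_cast Nat.choose_pos hik
  positivity

theorem fixedCoeff_nonneg {n k : ℕ} {θ : ℝ} {i : ℕ} (hik : i ≤ k)
    (h : 0 ≤ coeffSign n k θ i) : 0 ≤ fixedCoeff n k θ i := by
  rcases Nat.even_or_odd i with hi | hi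
  · rw [fixedCoeff_even hi hik]
    exact mul_nonneg (factor_pos hik).le h
  · rw [fixedCoeff_odd hi]

theorem fixedCoeff_nonpos {n k : ℕ} {θ : ℝ} {i : ℕ} (hik : i ≤ k)
    (h : coeffSign n k θ i ≤ 0) : fixedCoeff n k θ i ≤ 0 := by
  rcases Nat.even_or_odd i with hi | hi
  · rw [fixedCoeff_even hi hik]
    exact mul_nonpos_of_nonneg_of_nonpos (factor_pos hik).le h
  · rw [fixedCoeff_odd hi]

/-- The polynomial whose zeros are the nonzero solutions of the self-consistency equation. -/
noncomputable def fixedPoly (n k : ℕ) (θ s : ℝ) : ℝ :=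
  ∑ i ∈ Finset.range (k + 1), fixedCoeff n k θ i * s ^ i

theorem isFixed_iff {n k : ℕ} {θ s : ℝ} :
    IsFixed n k θ s ↔ s = 0 ∨ fixedPoly n k θ s = 0 := by
  rw [IsFixed, ← sub_eq_zero, fixed_sub_eq, mul_eq_zero, fixedPoly]

theorem fixedPoly_neg (n k : ℕ) (θ s : ℝ) : fixedPoly n k θ (-s) = fixedPoly n k θ s := by
  refine Finset.sum_congr rfl fun i _ => ?_
  rcases Nat.even_or_odd i with hi | hi
  · rw [hi.neg_pow]
  · rw [fixedCoeff_odd hi, zero_mul, zero_mul]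

theorem coeffSign_zero (n k : ℕ) (θ : ℝ) :
    coeffSign n k θ 0 = (2 * n + 3) - θ * (k * (2 * n + 1)) := by
  rw [coeffSign]; push_cast; ring

theorem isFixed_iff_of_le {n k : ℕ} (hk : 2 ≤ k) {θ : ℝ} (hθ : 0 ≤ θ)
    (h : θ ≤ (2 * (n : ℝ) + 3) / ((k : ℝ) * (2 * (n : ℝ) + 1))) {s : ℝ} :
    IsFixed n k θ s ↔ s = 0 := by
  rw [isFixed_iff, or_iff_left_iff_imp]
  intro hs
  by_contra hs0
  have hk0 : (0 : ℝ) < k := by exact_mod_cast (by omega : 0 < k)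
  rw [le_div_iff₀ (by positivity)] at h
  have h0 : 0 ≤ coeffSign n k θ 0 := by rw [coeffSign_zero]; linarith
  have hnn : ∀ i ≤ k, 0 ≤ coeffSign n k θ i := by
    intro i _
    rcases Nat.eq_zero_or_pos i with rfl | hi
    · exact h0
    · exact (coeffSign_pos hθ hi h0).le
  have hterm : ∀ i ∈ Finset.range (k + 1), 0 ≤ fixedCoeff n k θ i * s ^ i := by
    intro i hi
    have hik : i ≤ k := by simpa [Nat.lt_succ_iff] using hi
    rcases Nat.even_or_odd i with he | ho
    · exact mul_nonneg (fixedCoeff_nonneg hik (hnn i hik)) (he.pow_nonneg s)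
    · rw [fixedCoeff_odd ho, zero_mul]
  -- At θ = θ_c the constant coefficient vanishes, so strictness must come from the quadratic one,
  -- which is present because k ≥ 2.
  have h2 : 0 < fixedCoeff n k θ 2 * s ^ 2 := by
    rw [fixedCoeff_even even_two hk]
    exact mul_pos (mul_pos (factor_pos hk) (coeffSign_pos hθ two_pos h0))
      (by positivity)
  have : 0 < fixedPoly n k θ s :=
    Finset.sum_pos' hterm ⟨2, by simp; omega, h2⟩
  exact this.ne' hs

/-- A polynomial whose coefficients change sign once has at most one positive zero. -/
theorem sum_pos_of_lt_of_sign_change {K j : ℕ} {a : ℕ → ℝ} (hj : 0 < j) (h0 : a 0 < 0)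
    (hneg : ∀ i ≤ K, i < j → a i ≤ 0) (hpos : ∀ i ≤ K, j ≤ i → 0 ≤ a i) {x y : ℝ} (hx : 0 < x)
    (hxy : x < y) (hs : ∑ i ∈ Finset.range (K + 1), a i * x ^ i = 0) :
    0 < ∑ i ∈ Finset.range (K + 1), a i * y ^ i := by
  have hy := hx.trans hxy
  -- Dividing by the power at which the sign changes makes every term monotone: the sum over `s ^ j`
  -- is strictly increasing in `s > 0`. Cross-multiplication avoids the quotients.
  have hlt : ∑ i ∈ Finset.range (K + 1), a i * x ^ i * y ^ j <
      ∑ i ∈ Finset.range (K + 1), a i * y ^ i * x ^ j := by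
    refine Finset.sum_lt_sum (fun i hi => ?_) ⟨0, by simp, ?_⟩
    · have hiK : i ≤ K := by simpa [Nat.lt_succ_iff] using hi
      rw [mul_assoc, mul_assoc]
      rcases lt_or_ge i j with hij | hij
      · refine mul_le_mul_of_nonpos_left ?_ (hneg i hiK hij)
        obtain ⟨d, rfl⟩ := Nat.exists_eq_add_of_le hij.le
        calc y ^ i * x ^ (i + d) = x ^ i * y ^ i * x ^ d := by ring
          _ ≤ x ^ i * y ^ i * y ^ d := by gcongr
          _ = x ^ i * y ^ (i + d) := by ring
      · refine mul_le_mul_of_nonneg_left ?_ (hpos i hiK hij)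
        obtain ⟨d, rfl⟩ := Nat.exists_eq_add_of_le hij
        calc x ^ (j + d) * y ^ j = x ^ j * y ^ j * x ^ d := by ring
          _ ≤ x ^ j * y ^ j * y ^ d := by gcongr
          _ = y ^ (j + d) * x ^ j := by ring
    · rw [pow_zero, pow_zero, mul_one]
      exact mul_lt_mul_of_neg_left (pow_lt_pow_left₀ hxy hx.le hj.ne') h0
  rw [← Finset.sum_mul, hs, zero_mul, ← Finset.sum_mul] at hlt
  exact pos_of_mul_pos_left hlt (pow_pos hx j).le

/-- With w = (1 + t)^k ≥ 0 and t ≤ 1, the value is at least (1 - θ) ∫ w > 0. This places the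
positive root below 1, where the boundary weights are positive. -/
theorem fixedPoly_one_pos {n k : ℕ} {θ : ℝ} (hθ : 0 ≤ θ) (hθ₁ : θ < 1) :
    0 < fixedPoly n k θ 1 := by
  have h := fixed_sub_eq n k θ 1
  have hnn : ∀ u, 0 ≤ 1 + 1 * spin n u := fun u => by
    have := (abs_le.mp (abs_spin_le n u)).1
    linarith
  have hint0 : Integrable fun u => (1 + 1 * spin n u) ^ k := by
    refine integrable_of_bound (C := 2 ^ k) (((measurable_spin n).const_mul 1).const_add 1
      |>.pow_const k) fun u => ?_
    rw [abs_of_nonneg (pow_nonneg (hnn u) _)]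
    refine pow_le_pow_left₀ (hnn u) ?_ _
    have := (abs_le.mp (abs_spin_le n u)).2
    linarith
  have hle : ∀ u, |spin n u * (1 + 1 * spin n u) ^ k| ≤ (1 + 1 * spin n u) ^ k := fun u => by
    rw [abs_mul, abs_of_nonneg (pow_nonneg (hnn u) k)]
    exact mul_le_of_le_one_left (pow_nonneg (hnn u) _) (abs_spin_le n u)
  have hint1 : Integrable fun u => spin n u * (1 + 1 * spin n u) ^ k :=
    hint0.mono ((measurable_spin n).mul (((measurable_spin n).const_mul 1).const_add 1
      |>.pow_const k)).aestronglyMeasurable (ae_of_all _ fun u => by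
        rw [Real.norm_eq_abs, Real.norm_eq_abs, abs_of_nonneg (pow_nonneg (hnn u) k)]
        exact hle u)
  have h1 : ∫ u, spin n u * (1 + 1 * spin n u) ^ k ≤ ∫ u, (1 + 1 * spin n u) ^ k :=
    integral_mono hint1 hint0 fun u => (le_abs_self _).trans (hle u)
  have h2 : 1 ≤ ∫ u, (1 + 1 * spin n u) ^ k := by
    have h3 := integral_spin_pow_mul n k 0 1
    simp only [pow_zero, one_mul, add_zero, one_pow, mul_one] at h3
    simp only [one_mul, h3]
    have hm : ∀ i, 0 ≤ moment n i := fun i => by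
      rw [moment]; split_ifs
      · positivity
      · exact le_rfl
    have := Finset.single_le_sum (f := fun i => (k.choose i : ℝ) * moment n i)
      (fun i _ => mul_nonneg (Nat.cast_nonneg _) (hm i)) (Finset.mem_range.mpr k.succ_pos)
    refine le_trans ?_ this
    simp [moment, div_self (show (2 * (n : ℝ) + 1) ≠ 0 by positivity)]
  have h4 : θ * (∫ u, spin n u * (1 + 1 * spin n u) ^ k) ≤ θ * ∫ u, (1 + 1 * spin n u) ^ k :=
    mul_le_mul_of_nonneg_left h1 hθ
  have h5 : 0 < (1 - θ) * ∫ u, (1 + 1 * spin n u) ^ k := mul_pos (by linarith) (by linarith)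
  rw [fixedPoly]
  rw [one_mul (Finset.sum _ _)] at h
  linarith

theorem exists_isFixed_iff_of_lt {n k : ℕ} (hk : 2 ≤ k) {θ : ℝ} (hθ : 0 ≤ θ) (hθ₁ : θ < 1)
    (h : (2 * (n : ℝ) + 3) / ((k : ℝ) * (2 * (n : ℝ) + 1)) < θ) :
    ∃ z : ℝ, 0 < z ∧ z < 1 ∧ ∀ s, IsFixed n k θ s ↔ s = 0 ∨ s = z ∨ s = -z := by
  have hk0 : (0 : ℝ) < k := by exact_mod_cast (by omega : 0 < k)
  rw [div_lt_iff₀ (by positivity)] at h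
  have hs0 : coeffSign n k θ 0 < 0 := by rw [coeffSign_zero]; linarith
  have h0 : fixedCoeff n k θ 0 < 0 := by
    rw [fixedCoeff_even (by decide) (Nat.zero_le k)]
    exact mul_neg_of_pos_of_neg (factor_pos (Nat.zero_le k)) hs0
  -- At index `k` the term with θ vanishes. The least such index is where the sign changes.
  have hex : ∃ j, 0 ≤ coeffSign n k θ j := ⟨k, by rw [coeffSign, sub_self]; simp; positivity⟩
  classical
  have hj0 : 0 < Nat.find hex := by
    refine Nat.pos_of_ne_zero fun h0 => ?_
    have := Nat.find_spec hex
    rw [h0] at this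
    linarith
  have hneg : ∀ i ≤ k, i < Nat.find hex → fixedCoeff n k θ i ≤ 0 := fun i hik hi =>
    fixedCoeff_nonpos hik (not_le.mp (Nat.find_min hex hi)).le
  have hpos : ∀ i ≤ k, Nat.find hex ≤ i → 0 ≤ fixedCoeff n k θ i := fun i hik hi => by
    refine fixedCoeff_nonneg hik ?_
    rcases hi.eq_or_lt with h' | h'
    · rw [← h']; exact Nat.find_spec hex
    · exact (coeffSign_pos hθ h' (Nat.find_spec hex)).le
  have hcont : Continuous (fixedPoly n k θ) := by
    unfold fixedPoly; fun_prop
  have hP0 : fixedPoly n k θ 0 < 0 := by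
    rw [fixedPoly, Finset.sum_range_succ']
    simpa using h0
  have hP1 := fixedPoly_one_pos (n := n) (k := k) hθ hθ₁
  obtain ⟨z, hz, hz0⟩ := intermediate_value_Icc zero_le_one hcont.continuousOn
    (show (0 : ℝ) ∈ Set.Icc (fixedPoly n k θ 0) (fixedPoly n k θ 1) from ⟨hP0.le, hP1.le⟩)
  have hzpos : 0 < z := by
    refine lt_of_le_of_ne hz.1 ?_
    rintro rfl
    linarith
  have huniq : ∀ s, 0 < s → fixedPoly n k θ s = 0 → s = z := by
    intro s hs hs0
    rcases lt_trichotomy s z with hlt | heq | hlt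
    · exact absurd hz0 (sum_pos_of_lt_of_sign_change hj0 h0 hneg hpos hs hlt hs0).ne'
    · exact heq
    · exact absurd hs0 (sum_pos_of_lt_of_sign_change hj0 h0 hneg hpos hzpos hlt hz0).ne'
  have hz1 : z < 1 := by
    refine lt_of_le_of_ne hz.2 ?_
    rintro rfl
    linarith
  refine ⟨z, hzpos, hz1, fun s => ?_⟩
  rw [isFixed_iff]
  refine or_congr_right' fun hs => ⟨fun hP => ?_, ?_⟩
  · rcases lt_or_gt_of_ne hs with hs | hs
    · right
      rw [← huniq (-s) (by linarith) (by rwa [fixedPoly_neg]), neg_neg]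
    · exact Or.inl (huniq s hs hP)
  · rintro (rfl | rfl)
    · exact hz0
    · rwa [fixedPoly_neg]

end FixedPoint

/-! ### Existence of a measure with given consistent marginals, by compactness. -/

section Extension

open scoped ENNReal

variable {V : Type*}

/-- Consistent weights on an increasing sequence of finite sets are the marginals of a measure. -/
theorem exists_hasWeight_of_consistent [Countable V] {A : ℕ → Finset V}
    {w : ℕ → (V → unitInterval) → ℝ≥0∞} (hw : ∀ m, Measurable (w m))
    (hpos : ∀ m, ∫⁻ σ, w m σ ∂ref V ≠ 0) (hfin : ∀ m, ∫⁻ σ, w m σ ∂ref V ≠ ⊤)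
    (hcons : ∀ j m, j ≤ m → ∃ C : ℝ≥0∞, C ≠ 0 ∧ C ≠ ⊤ ∧ ∀ F : (V → unitInterval) → ℝ≥0∞,
      Measurable F → DependsOn F (A j) →
        ∫⁻ σ, F σ * w m σ ∂ref V = C * ∫⁻ σ, F σ * w j σ ∂ref V) :
    ∃ μ : Measure (V → unitInterval), IsProbabilityMeasure μ ∧ ∀ j, HasWeight μ (A j) (w j) := by
  let M : ℕ → Measure (V → unitInterval) :=
    fun m => (∫⁻ σ, w m σ ∂ref V)⁻¹ • (ref V).withDensity (w m)
  have hM : ∀ m, IsProbabilityMeasure (M m) := fun m => ⟨by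
    simp only [M, Measure.smul_apply, smul_eq_mul]
    rw [withDensity_apply _ MeasurableSet.univ, Measure.restrict_univ,
      ENNReal.inv_mul_cancel (hpos m) (hfin m)]⟩
  have hMint : ∀ m, ∀ F : (V → unitInterval) → ℝ≥0∞, Measurable F →
      ∫⁻ σ, F σ ∂M m = (∫⁻ σ, w m σ ∂ref V)⁻¹ * ∫⁻ σ, F σ * w m σ ∂ref V := by
    intro m F hF
    simp only [M]
    rw [lintegral_smul_measure, lintegral_withDensity_eq_lintegral_mul _ (hw m) hF, smul_eq_mul]
    simp only [Pi.mul_apply, mul_comm]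
  have hMw : ∀ j m, j ≤ m → HasWeight (M m) (A j) (w j) := by
    intro j m hjm
    obtain ⟨C, hC, hC', H⟩ := hcons j m hjm
    refine ⟨(∫⁻ σ, w m σ ∂ref V)⁻¹ * C, mul_ne_zero (ENNReal.inv_ne_zero.mpr (hfin m)) hC,
      ENNReal.mul_ne_top (ENNReal.inv_ne_top.mpr (hpos m)) hC', fun F hF hFA => ?_⟩
    rw [hMint m F hF, H F hF hFA, mul_assoc]
  let P : ℕ → ProbabilityMeasure (V → unitInterval) := fun m => ⟨M m, hM m⟩
  -- Probability measures on the compact space [0,1]^V form a compact space, so the `P m` converge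
  -- along a nonprincipal ultrafilter. The marginal on `A j` is constant for `m ≥ j` and so survives
  -- in the limit.
  let U : Ultrafilter (ProbabilityMeasure (V → unitInterval)) := (Filter.hyperfilter ℕ).map P
  have hlim : Filter.Tendsto P (Filter.hyperfilter ℕ) (nhds U.lim) := U.le_nhds_lim
  refine ⟨U.lim, inferInstance, fun j => ?_⟩
  have hcont : Continuous ((A j).restrict (π := fun _ => unitInterval)) :=
    continuous_pi fun x => continuous_apply _
  have h1 := (ProbabilityMeasure.continuous_map hcont).tendsto U.lim |>.comp hlim
  have h2 : ∀ᶠ m in (Filter.hyperfilter ℕ : Filter ℕ),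
      (P m).map hcont.measurable.aemeasurable = (P j).map hcont.measurable.aemeasurable := by
    filter_upwards [Nat.hyperfilter_le_atTop (Filter.eventually_ge_atTop j)] with m hm
    refine Subtype.ext ?_
    exact map_restrict_eq_of_lintegral_eq fun F hF hFA =>
      lintegral_eq_of_hasWeight (hMw j m hm) (hMw j j le_rfl) hF hFA
  have h3 := tendsto_nhds_unique h1 (tendsto_const_nhds.congr' (h2.mono fun m hm => hm.symm))
  have h4 : (U.lim : Measure (V → unitInterval)).map (A j).restrict =
      (M j).map (A j).restrict := congrArg Subtype.val h3
  obtain ⟨c, hc, hc', H⟩ := hMw j j le_rfl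
  exact ⟨c, hc, hc', fun F hF hFA => by
    rw [lintegral_eq_of_map_restrict_eq h4 hF hFA, H F hF hFA]⟩

end Extension

/-! ### The edge kernel and its action on tilts. -/

section Kernel

open scoped ENNReal

/-- The transfer kernel on an edge. -/
noncomputable def kernel (n : ℕ) (θ : ℝ) (e : Sym2 unitInterval) : ℝ≥0∞ :=
  ENNReal.ofReal (Real.exp (potential n θ e))

theorem kernel_mk {n : ℕ} {θ : ℝ} (hθ : |θ| < 1) (u v : unitInterval) :
    kernel n θ s(u, v) = ENNReal.ofReal (1 + θ * (spin n u * spin n v)) := by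
  rw [kernel, exp_potential n hθ]

theorem measurable_kernel (n : ℕ) (θ : ℝ) :
    Measurable fun p : unitInterval × unitInterval => kernel n θ s(p.1, p.2) :=
  (Real.measurable_exp.comp (measurable_potential n θ)).ennreal_ofReal

theorem kernel_ne_zero (n : ℕ) (θ : ℝ) (e : Sym2 unitInterval) : kernel n θ e ≠ 0 :=
  (ENNReal.ofReal_pos.mpr (Real.exp_pos _)).ne'

theorem kernel_ne_top (n : ℕ) (θ : ℝ) (e : Sym2 unitInterval) : kernel n θ e ≠ ⊤ :=
  ENNReal.ofReal_ne_top

theorem one_add_mul_le {a b : ℝ} (ha : |a| < 1) (hb : |b| ≤ 1) : 1 + a * b ≤ 2 := by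
  have : |a * b| ≤ 1 := by
    rw [abs_mul]; exact mul_le_one₀ ha.le (abs_nonneg _) hb
  linarith [(abs_le.mp this).2]

theorem abs_spin_mul_le (n : ℕ) (u v : unitInterval) : |spin n u * spin n v| ≤ 1 := by
  rw [abs_mul]
  exact mul_le_one₀ (abs_spin_le n u) (abs_nonneg _) (abs_spin_le n v)

theorem kernel_le {n : ℕ} {θ : ℝ} (hθ : |θ| < 1) (e : Sym2 unitInterval) :
    kernel n θ e ≤ 2 := by
  induction e with | _ u v
  rw [kernel_mk hθ]
  exact ENNReal.ofReal_le_of_le_toReal (one_add_mul_le hθ (abs_spin_mul_le n u v))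

/-- The boundary factor of a missing neighbour. -/
noncomputable def tilt (n : ℕ) (s : ℝ) (u : unitInterval) : ℝ≥0∞ :=
  ENNReal.ofReal (1 + s * spin n u)

theorem measurable_tilt (n : ℕ) (s : ℝ) : Measurable (tilt n s) :=
  (((measurable_spin n).const_mul s).const_add 1).ennreal_ofReal

theorem tilt_ne_zero {n : ℕ} {s : ℝ} (hs : |s| < 1) (u : unitInterval) : tilt n s u ≠ 0 :=
  (ENNReal.ofReal_pos.mpr (one_add_mul_pos hs (abs_spin_le n u))).ne'

theorem tilt_le {n : ℕ} {s : ℝ} (hs : |s| < 1) (u : unitInterval) : tilt n s u ≤ 2 :=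
  ENNReal.ofReal_le_of_le_toReal (one_add_mul_le hs (abs_spin_le n u))

theorem lintegral_ne_zero_of_ne_zero {α : Type*} [MeasurableSpace α] {μ : Measure α}
    [IsProbabilityMeasure μ] {f : α → ℝ≥0∞} (hf : Measurable f) (h : ∀ a, f a ≠ 0) :
    ∫⁻ a, f a ∂μ ≠ 0 := by
  rw [← pos_iff_ne_zero, lintegral_pos_iff_support hf,
    Set.eq_univ_of_forall fun a => Function.mem_support.mpr (h a)]
  simp

theorem lintegral_ne_top_of_le {α : Type*} [MeasurableSpace α] {μ : Measure α}
    [IsProbabilityMeasure μ] {f : α → ℝ≥0∞} {C : ℝ≥0∞} (hC : C ≠ ⊤) (h : ∀ a, f a ≤ C) :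
    ∫⁻ a, f a ∂μ ≠ ⊤ := by
  refine ne_top_of_le_ne_top hC ((lintegral_mono h).trans ?_)
  simp

theorem lintegral_tilt_pow_ne_zero {n k : ℕ} {s : ℝ} (hs : |s| < 1) :
    ∫⁻ u, tilt n s u ^ k ≠ 0 :=
  lintegral_ne_zero_of_ne_zero ((measurable_tilt n s).pow_const k)
    fun u => pow_ne_zero k (tilt_ne_zero hs u)

theorem lintegral_tilt_pow_ne_top {n k : ℕ} {s : ℝ} (hs : |s| < 1) :
    ∫⁻ u, tilt n s u ^ k ≠ ⊤ :=
  lintegral_ne_top_of_le (C := 2 ^ k) (by finiteness) fun u => by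
    gcongr; exact tilt_le hs u

theorem integrable_tilt {n k : ℕ} {s : ℝ} (hs : |s| < 1) :
    Integrable fun u => (1 + s * spin n u) ^ k := by
  refine integrable_of_bound (C := 2 ^ k) (((measurable_spin n).const_mul s).const_add 1
    |>.pow_const k) fun u => ?_
  have := (one_add_mul_pos hs (abs_spin_le n u)).le
  rw [abs_of_nonneg (pow_nonneg this _)]
  exact pow_le_pow_left₀ this (one_add_mul_le hs (abs_spin_le n u)) _

theorem integrable_spin_mul {n : ℕ} {f : unitInterval → ℝ} (hf : Integrable f) :
    Integrable fun u => spin n u * f u :=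
  hf.bdd_mul (measurable_spin n).aestronglyMeasurable (ae_of_all _ (abs_spin_le n))

/-- With w = (1 + s t)^k the left side is ∫ w + θ t(u) ∫ t w, and the self-consistency equation
turns θ ∫ t w into s ∫ w. -/
theorem lintegral_kernel_mul_tilt_pow {n k : ℕ} {θ s : ℝ} (hθ : |θ| < 1) (hs : |s| < 1)
    (hfix : IsFixed n k θ s) (u : unitInterval) :
    ∫⁻ v, kernel n θ s(u, v) * tilt n s v ^ k = (∫⁻ v, tilt n s v ^ k) * tilt n s u := by
  have hpos : ∀ v, 0 ≤ 1 + s * spin n v := fun v => (one_add_mul_pos hs (abs_spin_le n v)).le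
  have hpos' : ∀ v, 0 ≤ 1 + θ * (spin n u * spin n v) := fun v =>
    (one_add_mul_pos hθ (abs_spin_mul_le n u v)).le
  have h0 := integrable_tilt (n := n) (k := k) hs
  have h1 := integrable_spin_mul (n := n) h0
  have e1 : ∀ v, kernel n θ s(u, v) * tilt n s v ^ k = ENNReal.ofReal
      ((1 + s * spin n v) ^ k + θ * spin n u * (spin n v * (1 + s * spin n v) ^ k)) := by
    intro v
    rw [kernel_mk hθ, tilt, ← ENNReal.ofReal_pow (hpos v), ← ENNReal.ofReal_mul (hpos' v)]
    congr 1
    ring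
  have e2 : ∀ v, tilt n s v ^ k = ENNReal.ofReal ((1 + s * spin n v) ^ k) := fun v => by
    rw [tilt, ENNReal.ofReal_pow (hpos v)]
  simp only [e1]
  simp only [e2]
  rw [← ofReal_integral_eq_lintegral_ofReal, ← ofReal_integral_eq_lintegral_ofReal h0
    (ae_of_all _ fun v => pow_nonneg (hpos v) k), tilt,
    ← ENNReal.ofReal_mul (integral_nonneg fun v => pow_nonneg (hpos v) k),
    integral_add h0 (h1.const_mul _), integral_const_mul, mul_assoc, mul_left_comm, ← hfix]
  · congr 1; ring
  · exact h0.add (h1.const_mul _)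
  · refine ae_of_all _ fun v => ?_
    have := mul_nonneg (hpos' v) (pow_nonneg (hpos v) k)
    change 0 ≤ _
    linarith

end Kernel

/-! ### From a solution of the equation to an invariant splitting Gibbs measure. -/

section TreeWeight

open scoped ENNReal

variable {V : Type*} {G : SimpleGraph V} [G.LocallyFinite] {n k : ℕ} {θ s : ℝ}

open Classical in
/-- The interaction inside `A` with a factor `tilt` for every edge leaving `A`. -/
noncomputable def treeWeight (G : SimpleGraph V) [G.LocallyFinite] (n : ℕ) (θ s : ℝ) (A : Finset V)
    (σ : V → unitInterval) : ℝ≥0∞ :=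
  edgeWeight G (kernel n θ) A σ * ∏ x ∈ A, tilt n s (σ x) ^ (G.neighborFinset x \ A).card

theorem measurable_treeWeight (A : Finset V) : Measurable (treeWeight G n θ s A) :=
  (measurable_edgeWeight (measurable_kernel n θ) A).mul (Finset.measurable_prod _ fun x _ =>
    ((measurable_tilt n s).comp (measurable_pi_apply x)).pow_const _)

theorem treeWeight_ne_zero (hs : |s| < 1) (A : Finset V) (σ : V → unitInterval) :
    treeWeight G n θ s A σ ≠ 0 :=
  mul_ne_zero (Finset.prod_ne_zero_iff.mpr fun _ _ => kernel_ne_zero _ _ _)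
    (Finset.prod_ne_zero_iff.mpr fun _ _ => pow_ne_zero _ (tilt_ne_zero hs _))

theorem lintegral_treeWeight_ne_top (hθ : |θ| < 1) (hs : |s| < 1) (A : Finset V) :
    ∫⁻ σ, treeWeight G n θ s A σ ∂ref V ≠ ⊤ := by
  classical
  refine lintegral_ne_top_of_le
    (C := (∏ e ∈ edgesIn G A, 2) * ∏ x ∈ A, 2 ^ (G.neighborFinset x \ A).card) ?_ fun σ => ?_
  · exact ENNReal.mul_ne_top (ENNReal.prod_ne_top fun _ _ => by finiteness)
      (ENNReal.prod_ne_top fun _ _ => by finiteness)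
  · refine mul_le_mul' (Finset.prod_le_prod' fun e _ => kernel_le hθ _)
      (Finset.prod_le_prod' fun x _ => ?_)
    convert pow_le_pow_left' (tilt_le hs _) _

theorem treeWeight_map (φ : G ≃g G) (A : Finset V) (σ : V → unitInterval) :
    treeWeight G n θ s (A.map φ.toEquiv.toEmbedding) σ =
      treeWeight G n θ s A fun x => σ (φ x) := by
  classical
  rw [treeWeight, treeWeight, edgeWeight_map, Finset.prod_map]
  congr 1
  refine Finset.prod_congr rfl fun x _ => ?_
  have : G.neighborFinset (φ x) = (G.neighborFinset x).map φ.toEquiv.toEmbedding := by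
    ext y
    rw [Finset.mem_map_equiv, SimpleGraph.mem_neighborFinset, SimpleGraph.mem_neighborFinset]
    obtain ⟨y, rfl⟩ := φ.surjective y
    rw [φ.map_adj_iff]
    exact (iff_of_eq (congrArg _ (φ.symm_apply_apply y))).symm
  change tilt n s (σ (φ x)) ^ (G.neighborFinset (φ x) \ _).card = _
  rw [this, ← Finset.map_sdiff, Finset.card_map]

/-- The pendant vertex `y` has `k` edges leaving the larger set. Integrating it out leaves one tilt
at `x`, exactly the factor due to the edge `xy`, which now leaves `A`. -/
theorem lintegral_treeWeight_insert [DecidableEq V] (hreg : G.IsRegularOfDegree (k + 1))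
    (hθ : |θ| < 1) (hs : |s| < 1) (hfix : IsFixed n k θ s) {A : Finset V} {x y : V} (hy : y ∉ A)
    (hx : x ∈ A) (hxy : G.Adj x y) (hu : ∀ z ∈ A, G.Adj y z → z = x)
    {F : (V → unitInterval) → ℝ≥0∞} (hF : Measurable F) (hFA : DependsOn F A) :
    ∫⁻ σ, F σ * treeWeight G n θ s (insert y A) σ ∂ref V =
      (∫⁻ v, tilt n s v ^ k) * ∫⁻ σ, F σ * treeWeight G n θ s A σ ∂ref V := by
  let R : (V → unitInterval) → ℝ≥0∞ := fun σ => F σ * (edgeWeight G (kernel n θ) A σ *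
    ∏ z ∈ A, tilt n s (σ z) ^ (G.neighborFinset z \ insert y A).card)
  have hR : Measurable R := hF.mul ((measurable_edgeWeight (measurable_kernel n θ) A).mul
    (Finset.measurable_prod _ fun x _ =>
      ((measurable_tilt n s).comp (measurable_pi_apply x)).pow_const _))
  have hRA : DependsOn R A := by
    intro σ τ h
    simp only [R]
    rw [hFA h, dependsOn_edgeWeight A h]
    congr 2
    exact Finset.prod_congr rfl fun z hz => by rw [h z hz]
  have hyk : (G.neighborFinset y \ insert y A).card = k := by
    have : G.neighborFinset y \ insert y A = (G.neighborFinset y).erase x := by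
      ext z
      simp only [Finset.mem_sdiff, SimpleGraph.mem_neighborFinset, Finset.mem_insert,
        Finset.mem_erase, not_or]
      constructor
      · rintro ⟨h1, -, h2⟩
        exact ⟨fun h => h2 (h ▸ hx), h1⟩
      · rintro ⟨h1, h2⟩
        exact ⟨h2, h2.ne.symm, fun h => h1 (hu z h h2)⟩
    rw [this, Finset.card_erase_of_mem (by simpa using hxy.symm),
      SimpleGraph.card_neighborFinset_eq_degree, hreg y]
    rfl
  have e1 : ∀ σ, F σ * treeWeight G n θ s (insert y A) σ =
      R σ * (kernel n θ s(σ x, σ y) * tilt n s (σ y) ^ k) := by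
    intro σ
    rw [treeWeight, edgeWeight_insert hy hx hxy hu, Finset.prod_insert hy]
    simp only [R]
    rw [← hyk]
    convert_to _ = F σ * (edgeWeight G (kernel n θ) A σ *
      ∏ z ∈ A, tilt n s (σ z) ^ (G.neighborFinset z \ insert y A).card) *
      (kernel n θ s(σ x, σ y) * tilt n s (σ y) ^ (G.neighborFinset y \ insert y A).card)
    ring_nf
    congr!
  have e2 : ∀ σ, F σ * treeWeight G n θ s A σ = R σ * tilt n s (σ x) := by
    intro σ
    -- Only `x` is adjacent to `y`, so only its count of leaving edges changes, by one.
    have : ∀ z ∈ A, tilt n s (σ z) ^ (G.neighborFinset z \ A).card =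
        tilt n s (σ z) ^ (G.neighborFinset z \ insert y A).card *
          if z = x then tilt n s (σ z) else 1 := by
      intro z hz
      split_ifs with hzx
      · subst hzx
        rw [← pow_succ, Finset.sdiff_insert, Finset.card_erase_add_one]
        simpa using ⟨hxy, hy⟩
      · rw [mul_one, Finset.sdiff_insert, Finset.erase_eq_of_notMem]
        rw [Finset.mem_sdiff, SimpleGraph.mem_neighborFinset]
        exact fun h => hzx (hu z hz h.1.symm)
    have hprod : ∏ z ∈ A, tilt n s (σ z) ^ (G.neighborFinset z \ A).card =
        (∏ z ∈ A, tilt n s (σ z) ^ (G.neighborFinset z \ insert y A).card) * tilt n s (σ x) := by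
      rw [Finset.prod_congr rfl this, Finset.prod_mul_distrib, Finset.prod_ite_eq' A x, if_pos hx]
    simp only [R]
    rw [mul_assoc, mul_assoc, ← hprod, treeWeight]
    congr!
  simp only [e1]
  rw [lintegral_pendant (κ := fun u v => kernel n θ s(u, v)) (measurable_kernel n θ)
    ((measurable_tilt n s).pow_const k) hxy.ne hR
    (update_eq_of_dependsOn hRA (by simpa using hy))]
  simp only [lintegral_kernel_mul_tilt_pow hθ hs hfix, e2]
  rw [← lintegral_const_mul _ (f := fun σ => R σ * tilt n s (σ x))
    (hR.mul ((measurable_tilt n s).comp (measurable_pi_apply x)))]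
  exact lintegral_congr fun σ => mul_left_comm _ _ _

/-- The two balls may have different centres: `b = r` is needed for existence of the measure, `b = φ
r` for its invariance. -/
theorem exists_lintegral_treeWeight_eq (hG : G.IsTree) (hreg : G.IsRegularOfDegree (k + 1))
    (hθ : |θ| < 1) (hs : |s| < 1) (hfix : IsFixed n k θ s) {r b : V} {m j : ℕ}
    (hb : b ∈ ball G r m) (hj : ball G b j ⊆ ball G r m) :
    ∃ C : ℝ≥0∞, C ≠ 0 ∧ C ≠ ⊤ ∧ ∀ F : (V → unitInterval) → ℝ≥0∞,
      Measurable F → DependsOn F (ball G b j) →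
        ∫⁻ σ, F σ * treeWeight G n θ s (ball G r m) σ ∂ref V =
          C * ∫⁻ σ, F σ * treeWeight G n θ s (ball G b j) σ ∂ref V := by
  refine peel_induction hG (b := b) (j := j) (P := fun A => ∃ C : ℝ≥0∞, C ≠ 0 ∧ C ≠ ⊤ ∧
    ∀ F : (V → unitInterval) → ℝ≥0∞, Measurable F → DependsOn F (ball G b j) →
      ∫⁻ σ, F σ * treeWeight G n θ s (ball G r m) σ ∂ref V =
        C * ∫⁻ σ, F σ * treeWeight G n θ s A σ ∂ref V) ?_ (ball G r m) hj
    (fun y hy p => ball_lower_closed hG hb hy) ⟨1, one_ne_zero, by finiteness, by simp⟩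
  classical
  rintro A x y hA hy hx hxy hu ⟨C, hC, hC', H⟩
  refine ⟨C * ∫⁻ v, tilt n s v ^ k, mul_ne_zero hC (lintegral_tilt_pow_ne_zero hs),
    ENNReal.mul_ne_top hC' (lintegral_tilt_pow_ne_top hs), fun F hF hFA => ?_⟩
  rw [H F hF hFA, lintegral_treeWeight_insert hreg hθ hs hfix hy hx hxy hu hF
    (hFA.mono (by exact_mod_cast hA)), mul_assoc]

theorem exists_hasWeight_treeWeight (hG : G.IsTree) (hreg : G.IsRegularOfDegree (k + 1))
    (hθ : |θ| < 1) (hs : |s| < 1) (hfix : IsFixed n k θ s) (r : V) :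
    ∃ μ : Measure (V → unitInterval), IsProbabilityMeasure μ ∧
      ∀ m, HasWeight μ (ball G r m) (treeWeight G n θ s (ball G r m)) := by
  have := countable_of_connected hG r
  refine exists_hasWeight_of_consistent (fun m => measurable_treeWeight _)
    (fun m => lintegral_ne_zero_of_ne_zero (measurable_treeWeight _) (treeWeight_ne_zero hs _))
    (fun m => lintegral_treeWeight_ne_top hθ hs _) fun j m hjm => ?_
  refine exists_lintegral_treeWeight_eq hG hreg hθ hs hfix (by simp [mem_ball hG]) fun x hx => ?_
  rw [mem_ball hG] at hx ⊢
  omega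

theorem map_ball (φ : G ≃g G) (hG : G.IsTree) (r : V) (m : ℕ) :
    (ball G r m).map φ.toEquiv.toEmbedding = ball G (φ r) m := by
  have hle : ∀ (ψ : G ≃g G) (a b : V), G.dist (ψ a) (ψ b) ≤ G.dist a b := by
    intro ψ a b
    obtain ⟨w, hw⟩ := hG.connected.exists_walk_length_eq_dist a b
    rw [← hw, ← SimpleGraph.Walk.length_map ψ.toHom]
    exact G.dist_le _
  ext x
  rw [Finset.mem_map_equiv, mem_ball hG, mem_ball hG]
  have h1 := hle φ r (φ.symm x)
  have h2 := hle φ.symm (φ r) x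
  rw [φ.apply_symm_apply] at h1
  rw [φ.symm_apply_apply] at h2
  exact ⟨fun h => h1.trans h, fun h => h2.trans h⟩

theorem isTranslationInvariant_of_hasWeight (hG : G.IsTree) (hreg : G.IsRegularOfDegree (k + 1))
    (hθ : |θ| < 1) (hs : |s| < 1) (hfix : IsFixed n k θ s) {r : V}
    {μ : Measure (V → unitInterval)} [IsProbabilityMeasure μ]
    (hμ : ∀ m, 1 ≤ m → HasWeight μ (ball G r m) (treeWeight G n θ s (ball G r m))) :
    IsTranslationInvariant G μ := by
  intro φ
  have hφ : Measurable fun (σ : V → unitInterval) x => σ (φ x) :=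
    measurable_pi_lambda _ fun x => measurable_pi_apply _
  have : IsProbabilityMeasure (μ.map fun σ x => σ (φ x)) :=
    Measure.isProbabilityMeasure_map hφ.aemeasurable
  refine eq_of_hasWeight_ball hG (fun m hm => ?_) hμ
  -- The marginal on the moved ball is computed from a ball around `r` large enough to contain it.
  have hsub : ball G (φ r) m ⊆ ball G r (m + G.dist r (φ r)) := fun x hx => by
    rw [mem_ball hG] at hx ⊢
    have := hG.connected.dist_triangle (u := r) (v := φ r) (w := x)
    omega
  obtain ⟨C, hC, hC', H⟩ := exists_lintegral_treeWeight_eq (m := m + G.dist r (φ r)) hG hreg hθ hs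
    hfix (by rw [mem_ball hG]; omega) hsub
  obtain ⟨c, hc, hc', K⟩ := hμ (m + G.dist r (φ r)) (by omega)
  refine ⟨c * C, mul_ne_zero hc hC, ENNReal.mul_ne_top hc' hC', fun F hF hFA => ?_⟩
  have hdep : DependsOn (fun σ : V → unitInterval => F fun x => σ (φ x)) (ball G (φ r) m) := by
    intro σ τ h
    refine hFA fun x hx => h _ ?_
    rw [← map_ball φ hG]
    exact Finset.mem_coe.mpr (Finset.mem_map_of_mem _ hx)
  rw [lintegral_map hF hφ, K (fun σ => F fun x => σ (φ x)) (hF.comp hφ)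
    (hdep.mono (by exact_mod_cast hsub)), H (fun σ => F fun x => σ (φ x)) (hF.comp hφ) hdep, mul_assoc, ← map_ball φ hG]
  simp only [treeWeight_map]
  congr 2
  exact (measurePreserving_reindex φ.toEquiv).lintegral_comp
    (f := fun σ => F σ * treeWeight G n θ s (ball G r m) σ) (hF.mul (measurable_treeWeight _))

/-- A vertex of the sphere has `k` neighbours outside the ball and an inner vertex has none. Radius
0 is excluded, since there the root would have `k + 1`. -/
theorem ballWeight_eq_treeWeight (hG : G.IsTree) (hreg : G.IsRegularOfDegree (k + 1)) (r : V)
    {m : ℕ} (hm : 1 ≤ m) (σ : V → unitInterval) :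
    ballWeight G (kernel n θ) r (fun _ u => tilt n s u ^ k) m σ =
      treeWeight G n θ s (ball G r m) σ := by
  classical
  rw [ballWeight, treeWeight]
  congr 1
  have hsub : sphere G r m ⊆ ball G r m := Finset.filter_subset _ _
  rw [← Finset.prod_subset hsub]
  · refine Finset.prod_congr rfl fun x hx => ?_
    rw [mem_sphere hG] at hx
    obtain ⟨p, hxp, hp⟩ := exists_lower_adj hG (r := r) (x := x)
      (by rintro rfl; simp at hx; omega)
    have : G.neighborFinset x \ ball G r m = (G.neighborFinset x).erase p := by
      ext z
      simp only [Finset.mem_sdiff, SimpleGraph.mem_neighborFinset, Finset.mem_erase, mem_ball hG]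
      constructor
      · rintro ⟨h1, h2⟩
        refine ⟨?_, h1⟩
        rintro rfl
        omega
      · rintro ⟨h1, h2⟩
        refine ⟨h2, fun h3 => h1 (lower_unique hG h2 ?_ hxp hp)⟩
        rcases hG.dist_eq_dist_add_one_of_adj r h2 with h | h <;> omega
    rw [this, Finset.card_erase_of_mem (by simpa using hxp),
      SimpleGraph.card_neighborFinset_eq_degree, hreg x]
    rfl
  · intro x hx hx'
    rw [mem_sphere hG] at hx'
    rw [mem_ball hG] at hx
    have : G.neighborFinset x \ ball G r m = ∅ := by
      rw [Finset.sdiff_eq_empty_iff_subset]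
      intro z hz
      rw [SimpleGraph.mem_neighborFinset] at hz
      rw [mem_ball hG]
      rcases hG.dist_eq_dist_add_one_of_adj r hz with h | h <;> omega
    rw [this, Finset.card_empty, pow_zero]

theorem isSplittingGibbs_of_hasWeight (hG : G.IsTree) (hreg : G.IsRegularOfDegree (k + 1))
    (hs : |s| < 1) {r : V} {μ : Measure (V → unitInterval)} [IsProbabilityMeasure μ]
    (hμ : ∀ m, 1 ≤ m → HasWeight μ (ball G r m) (treeWeight G n θ s (ball G r m))) :
    IsSplittingGibbs G (potential n θ) 1 r μ := by
  rw [isSplittingGibbs_iff hG (measurable_potential n θ)]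
  refine ⟨inferInstance, fun _ u => Real.log ((1 + s * spin n u) ^ k), fun _ =>
    Real.measurable_log.comp ((((measurable_spin n).const_mul s).const_add 1).pow_const k),
    fun m hm => ?_⟩
  have hq : (fun (_ : V) (u : unitInterval) =>
      ENNReal.ofReal (Real.exp (Real.log ((1 + s * spin n u) ^ k)))) =
      fun _ u => tilt n s u ^ k := by
    funext _ u
    have h := one_add_mul_pos hs (abs_spin_le n u)
    rw [Real.exp_log (pow_pos h k), ENNReal.ofReal_pow h.le, tilt]
  rw [hq]
  have := hμ m hm
  rwa [← funext (ballWeight_eq_treeWeight hG hreg r hm)] at this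

end TreeWeight

/-! ### The law of a spin with one interaction removed. -/

section CondMeasure

open scoped ENNReal

variable {V : Type*} {n : ℕ} {θ : ℝ}

/-- The law of the spin at `x` when the interaction across the edge from `p` to `x` is removed
(not normalized). -/
noncomputable def condMeasure (n : ℕ) (θ : ℝ) (μ : Measure (V → unitInterval)) (p x : V) :
    Measure unitInterval :=
  (μ.withDensity fun σ => (kernel n θ s(σ p, σ x))⁻¹).map fun σ => σ x

theorem measurable_kernel_left (n : ℕ) (θ : ℝ) (u : unitInterval) :
    Measurable fun v => kernel n θ s(u, v) :=
  Measurable.of_uncurry_left (f := fun u v => kernel n θ s(u, v)) (measurable_kernel n θ)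

theorem measurable_kernel_inv (n : ℕ) (θ : ℝ) (p x : V) :
    Measurable fun σ : V → unitInterval => (kernel n θ s(σ p, σ x))⁻¹ :=
  (measurable_comp_pair (κ := fun u v => kernel n θ s(u, v)) (measurable_kernel n θ) p x).inv

theorem condMeasure_apply (μ : Measure (V → unitInterval)) (p x : V) {S : Set unitInterval}
    (hS : MeasurableSet S) : condMeasure n θ μ p x S =
      ∫⁻ σ, (kernel n θ s(σ p, σ x))⁻¹ * S.indicator 1 (σ x) ∂μ := by
  have h1 : Measurable (S.indicator (1 : unitInterval → ℝ≥0∞)) := measurable_one.indicator hS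
  rw [condMeasure, ← lintegral_indicator_one hS, lintegral_map h1 (measurable_pi_apply x),
    lintegral_withDensity_eq_lintegral_mul (g := fun σ : V → unitInterval => S.indicator 1 (σ x)) _
      (measurable_kernel_inv n θ p x) (h1.comp (measurable_pi_apply x))]
  rfl

theorem kernel_inv_le (hθ : |θ| < 1) (e : Sym2 unitInterval) :
    (kernel n θ e)⁻¹ ≤ (ENNReal.ofReal (1 - |θ|))⁻¹ := by
  refine ENNReal.inv_le_inv.mpr ?_
  induction e with | _ u v
  rw [kernel_mk hθ]
  refine ENNReal.ofReal_le_ofReal ?_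
  have h : |θ * (spin n u * spin n v)| ≤ |θ| := by
    rw [abs_mul]
    exact mul_le_of_le_one_right (abs_nonneg _) (abs_spin_mul_le n u v)
  linarith [(abs_le.mp h).1]

theorem condMeasure_univ_ne_zero (μ : Measure (V → unitInterval)) [IsProbabilityMeasure μ]
    (p x : V) : condMeasure n θ μ p x Set.univ ≠ 0 := by
  rw [condMeasure_apply μ p x MeasurableSet.univ]
  simp only [Set.indicator_univ, Pi.one_apply, mul_one]
  exact lintegral_ne_zero_of_ne_zero (measurable_kernel_inv n θ p x)
    fun σ => ENNReal.inv_ne_zero.mpr (kernel_ne_top n θ _)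

theorem isFiniteMeasure_condMeasure (hθ : |θ| < 1) (μ : Measure (V → unitInterval))
    [IsProbabilityMeasure μ] (p x : V) : IsFiniteMeasure (condMeasure n θ μ p x) := by
  refine ⟨?_⟩
  rw [condMeasure_apply μ p x MeasurableSet.univ, lt_top_iff_ne_top]
  simp only [Set.indicator_univ, Pi.one_apply, mul_one]
  refine lintegral_ne_top_of_le (ENNReal.inv_ne_top.mpr ?_) fun σ => kernel_inv_le hθ _
  exact (ENNReal.ofReal_pos.mpr (by linarith)).ne'

/-- Dividing out the kernel decouples the spin at `x` from all others, so its law has density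
proportional to `Q`. -/
theorem condMeasure_eq_of_hasWeight [DecidableEq V] (hθ : |θ| < 1)
    {μ : Measure (V → unitInterval)} [IsProbabilityMeasure μ] {B : Finset V} {p x : V}
    (hp : p ∈ B) (hx : x ∈ B) {Q : unitInterval → ℝ≥0∞} (hQ : Measurable Q) (hQ0 : ∀ u, Q u ≠ 0)
    {R : (V → unitInterval) → ℝ≥0∞} (hR : Measurable R)
    (hRx : ∀ σ v, R (Function.update σ x v) = R σ)
    (h : HasWeight μ B fun σ => kernel n θ s(σ p, σ x) * (Q (σ x) * R σ)) :
    ∃ c : ℝ≥0∞, c ≠ 0 ∧ c ≠ ⊤ ∧ condMeasure n θ μ p x = c • volume.withDensity Q := by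
  obtain ⟨c, hc, hc', H⟩ := h
  have key : condMeasure n θ μ p x = (c * ∫⁻ σ, R σ ∂ref V) • volume.withDensity Q := by
    ext S hS
    have h1 : Measurable (S.indicator (1 : unitInterval → ℝ≥0∞)) := measurable_one.indicator hS
    rw [condMeasure_apply μ p x hS, H (fun σ => (kernel n θ s(σ p, σ x))⁻¹ * S.indicator 1 (σ x))
      ((measurable_kernel_inv n θ p x).mul
      (h1.comp (measurable_pi_apply x)))]
    · have e : ∀ σ : V → unitInterval, (kernel n θ s(σ p, σ x))⁻¹ * S.indicator 1 (σ x) *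
          (kernel n θ s(σ p, σ x) * (Q (σ x) * R σ)) = S.indicator Q (σ x) * R σ := by
        intro σ
        have hk := ENNReal.inv_mul_cancel (kernel_ne_zero n θ s(σ p, σ x))
          (kernel_ne_top n θ s(σ p, σ x))
        calc _ = (kernel n θ s(σ p, σ x))⁻¹ * kernel n θ s(σ p, σ x) *
              (S.indicator 1 (σ x) * Q (σ x)) * R σ := by ring
          _ = _ := by
            rw [hk, one_mul]
            congr 1
            by_cases hs : σ x ∈ S <;> simp [hs]
      simp only [e]
      rw [lintegral_eval_mul (hQ.indicator hS) hR hRx, Measure.smul_apply, smul_eq_mul,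
        withDensity_apply _ hS, lintegral_indicator hS]
      ring
    · intro σ τ hστ
      simp only [hστ p hp, hστ x hx]
  -- The integral of `R` is not known to be positive and finite; this is read off from the total
  -- mass of `condMeasure`.
  have hu := congrArg (fun ν => ν Set.univ) key
  simp only [Measure.smul_apply, smul_eq_mul, withDensity_apply _ MeasurableSet.univ,
    Measure.restrict_univ] at hu
  refine ⟨_, ?_, ?_, key⟩
  · intro h0
    rw [h0, zero_mul] at hu
    exact condMeasure_univ_ne_zero μ p x hu
  · intro h0
    rw [h0, ENNReal.top_mul (lintegral_ne_zero_of_ne_zero hQ hQ0)] at hu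
    have := isFiniteMeasure_condMeasure (n := n) hθ μ p x
    exact measure_ne_top _ _ hu

theorem condMeasure_map {G : SimpleGraph V} {μ : Measure (V → unitInterval)}
    (hμ : IsTranslationInvariant G μ) (φ : G ≃g G) (p x : V) :
    condMeasure n θ μ (φ p) (φ x) = condMeasure n θ μ p x := by
  ext S hS
  have h1 : Measurable (S.indicator (1 : unitInterval → ℝ≥0∞)) := measurable_one.indicator hS
  have hφ : Measurable fun (σ : V → unitInterval) x => σ (φ x) :=
    measurable_pi_lambda _ fun x => measurable_pi_apply _
  have hF : Measurable fun σ : V → unitInterval =>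
      (kernel n θ s(σ p, σ x))⁻¹ * S.indicator 1 (σ x) :=
    (measurable_kernel_inv n θ p x).mul (h1.comp (measurable_pi_apply x))
  have h2 := lintegral_map (μ := μ) hF hφ
  rw [show μ.map (fun σ x => σ (φ x)) = μ from hμ φ] at h2
  rw [condMeasure_apply μ p x hS, h2, condMeasure_apply μ (φ p) (φ x) hS]

/-- Integrating out several pendant neighbours of `x`. -/
theorem lintegral_pendants [DecidableEq V] {κ : unitInterval → unitInterval → ℝ≥0∞}
    (hκ : Measurable fun p : unitInterval × unitInterval => κ p.1 p.2)
    {q : V → unitInterval → ℝ≥0∞} (hq : ∀ y, Measurable (q y)) {x : V} {S : Finset V} (hx : x ∉ S)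
    {R : (V → unitInterval) → ℝ≥0∞} (hR : Measurable R)
    (hRS : ∀ y ∈ S, ∀ σ v, R (Function.update σ y v) = R σ) :
    ∫⁻ σ, R σ * ∏ y ∈ S, (κ (σ x) (σ y) * q y (σ y)) ∂ref V =
      ∫⁻ σ, R σ * ∏ y ∈ S, (∫⁻ v, κ (σ x) v * q y v) ∂ref V := by
  induction S using Finset.induction_on generalizing R with
  | empty => simp
  | insert y S hy ih =>
    rw [Finset.mem_insert, not_or] at hx
    have hQ : Measurable fun u => ∫⁻ v, κ u v * q y v :=
      (hκ.mul ((hq y).comp measurable_snd)).lintegral_prod_right'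
    have hprod : Measurable fun σ : V → unitInterval => ∏ z ∈ S, (κ (σ x) (σ z) * q z (σ z)) :=
      Finset.measurable_prod _ fun z _ =>
        (measurable_comp_pair hκ x z).mul ((hq z).comp (measurable_pi_apply z))
    have e1 : ∀ σ : V → unitInterval, R σ * ∏ z ∈ insert y S, (κ (σ x) (σ z) * q z (σ z)) =
        (R σ * ∏ z ∈ S, (κ (σ x) (σ z) * q z (σ z))) * (κ (σ x) (σ y) * q y (σ y)) := by
      intro σ
      rw [Finset.prod_insert hy]
      ring
    have e2 : ∀ σ : V → unitInterval, R σ * ∏ z ∈ insert y S, (∫⁻ v, κ (σ x) v * q z v) =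
        (R σ * ∫⁻ v, κ (σ x) v * q y v) * ∏ z ∈ S, (∫⁻ v, κ (σ x) v * q z v) := by
      intro σ
      rw [Finset.prod_insert hy, mul_assoc]
    simp only [e1, e2]
    rw [lintegral_pendant (R := fun σ => R σ * ∏ z ∈ S, (κ (σ x) (σ z) * q z (σ z)))
      hκ (hq y) hx.1 (hR.mul hprod), ← ih hx.2 (R := fun σ => R σ * ∫⁻ v, κ (σ x) v * q y v) (hR.mul (hQ.comp (measurable_pi_apply x)))]
    · exact lintegral_congr fun σ => mul_right_comm _ _ _
    · intro z hz σ v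
      rw [hRS z (Finset.mem_insert_of_mem hz),
        Function.update_of_ne (show x ≠ z from fun h => hx.2 (h ▸ hz))]
    · intro σ v
      rw [hRS y (Finset.mem_insert_self y S), Function.update_of_ne hx.1]
      congr 1
      refine Finset.prod_congr rfl fun z hz => ?_
      rw [Function.update_of_ne (show z ≠ y from fun h => hy (h ▸ hz))]

theorem edgeWeight_union_pendants [DecidableEq V] {G : SimpleGraph V} {κ : Sym2 unitInterval → ℝ≥0∞} {B S : Finset V}
    {x : V} (hx : x ∈ B) (hBS : Disjoint B S) (hxS : ∀ y ∈ S, G.Adj x y)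
    (hu : ∀ y ∈ S, ∀ z ∈ B ∪ S, G.Adj y z → z = x) (σ : V → unitInterval) :
    edgeWeight G κ (B ∪ S) σ = edgeWeight G κ B σ * ∏ y ∈ S, κ s(σ x, σ y) := by
  induction S using Finset.induction_on with
  | empty => simp
  | insert y S hy ih =>
    rw [Finset.disjoint_insert_right] at hBS
    have hsub : B ∪ S ⊆ B ∪ insert y S :=
      Finset.union_subset_union_right (Finset.subset_insert y S)
    rw [Finset.union_insert, edgeWeight_insert (x := x), ih hBS.2
      (fun z hz => hxS z (Finset.mem_insert_of_mem hz))
      (fun z hz w hw => hu z (Finset.mem_insert_of_mem hz) w (hsub hw)), Finset.prod_insert hy]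
    · ring
    · rw [Finset.mem_union, not_or]; exact ⟨hBS.1, hy⟩
    · exact Finset.mem_union_left _ hx
    · exact hxS y (Finset.mem_insert_self y S)
    · exact fun z hz => hu y (Finset.mem_insert_self y S) z (hsub hz)

end CondMeasure

/-! ### The removed-edge law computed at the boundary and one step inside. -/

section BallWeight

open scoped ENNReal

variable {V : Type*} {G : SimpleGraph V} [G.LocallyFinite] {n k : ℕ} {θ : ℝ}

/-- With radius `G.dist r x` the vertex `x` lies on the sphere and interacts only with its parent,
so only its own boundary factor remains. -/
theorem condMeasure_eq_boundary (hG : G.IsTree) (hθ : |θ| < 1) {r p x : V}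
    {μ : Measure (V → unitInterval)} [IsProbabilityMeasure μ] {q : V → unitInterval → ℝ≥0∞}
    (hq : ∀ x, Measurable (q x)) (hq0 : ∀ x u, q x u ≠ 0) (hxp : G.Adj x p)
    (hd : G.dist r x = G.dist r p + 1)
    (h : HasWeight μ (ball G r (G.dist r x)) (ballWeight G (kernel n θ) r q (G.dist r x))) :
    ∃ c : ℝ≥0∞, c ≠ 0 ∧ c ≠ ⊤ ∧ condMeasure n θ μ p x = c • volume.withDensity (q x) := by
  classical
  have hxb : x ∈ ball G r (G.dist r x) := (mem_ball hG).mpr le_rfl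
  have hpb : p ∈ ball G r (G.dist r x) := (mem_ball hG).mpr (by omega)
  have hxs : x ∈ sphere G r (G.dist r x) := (mem_sphere hG).mpr rfl
  let R : (V → unitInterval) → ℝ≥0∞ := fun σ =>
    edgeWeight G (kernel n θ) ((ball G r (G.dist r x)).erase x) σ *
      ∏ y ∈ (sphere G r (G.dist r x)).erase x, q y (σ y)
  have hR : Measurable R := (measurable_edgeWeight (measurable_kernel n θ) _).mul
    (Finset.measurable_prod _ fun y _ => (hq y).comp (measurable_pi_apply y))
  refine condMeasure_eq_of_hasWeight hθ hpb hxb (hq x) (hq0 x) (R := R) hR ?_ ?_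
  · intro σ v
    simp only [R]
    rw [update_eq_of_dependsOn (dependsOn_edgeWeight _) (by simp)]
    congr 1
    exact Finset.prod_congr rfl fun y hy => by
      rw [Function.update_of_ne (Finset.ne_of_mem_erase hy)]
  · convert h using 2 with σ
    have hu : ∀ z ∈ (ball G r (G.dist r x)).erase x, G.Adj x z → z = p := by
      intro z hz hxz
      have hz := (mem_ball hG).mp (Finset.mem_of_mem_erase hz)
      refine lower_unique hG hxz ?_ hxp hd
      rcases hG.dist_eq_dist_add_one_of_adj r hxz with h | h <;> omega
    have he := edgeWeight_insert (κ := kernel n θ) (Finset.notMem_erase x _)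
      (Finset.mem_erase.mpr ⟨hxp.symm.ne, hpb⟩) hxp.symm hu σ
    rw [Finset.insert_erase hxb] at he
    rw [ballWeight, he, ← Finset.mul_prod_erase _ _ hxs]
    simp only [R]
    ring

-- With the radius one larger, the other neighbours of `x` lie on the sphere and are pendant, so
-- each integrates out to a function of the spin at `x`.
open Classical in
theorem condMeasure_eq_interior (hG : G.IsTree) (hθ : |θ| < 1) {r p x : V}
    {μ : Measure (V → unitInterval)} [IsProbabilityMeasure μ] {q : V → unitInterval → ℝ≥0∞}
    (hq : ∀ x, Measurable (q x)) (hq0 : ∀ x u, q x u ≠ 0) (hxp : G.Adj x p)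
    (hd : G.dist r x = G.dist r p + 1) (h : HasWeight μ (ball G r (G.dist r x + 1))
      (ballWeight G (kernel n θ) r q (G.dist r x + 1))) :
    ∃ c : ℝ≥0∞, c ≠ 0 ∧ c ≠ ⊤ ∧ condMeasure n θ μ p x = c • volume.withDensity fun u =>
      ∏ y ∈ (G.neighborFinset x).erase p, ∫⁻ v, kernel n θ s(u, v) * q y v := by
  set S := (G.neighborFinset x).erase p with hS
  set m := G.dist r x with hm
  have hSmem : ∀ {y}, y ∈ S ↔ G.Adj x y ∧ y ≠ p := fun {y} => by
    rw [hS, Finset.mem_erase, SimpleGraph.mem_neighborFinset, and_comm]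
  have hSd : ∀ y ∈ S, G.dist r y = m + 1 := by
    intro y hy
    obtain ⟨hxy, hyp⟩ := hSmem.mp hy
    rcases hG.dist_eq_dist_add_one_of_adj r hxy with h | h
    · exact absurd (lower_unique hG hxy h hxp hd) hyp
    · exact h
  have hxS : x ∉ S := fun h => (hSmem.mp h).1.ne rfl
  have hpS : p ∉ S := fun h => (hSmem.mp h).2 rfl
  set B := ball G r (m + 1) \ S with hB
  have hSsph : S ⊆ sphere G r (m + 1) := fun y hy => (mem_sphere hG).mpr (hSd y hy)
  have hSball : S ⊆ ball G r (m + 1) := fun y hy => (mem_ball hG).mpr (hSd y hy).le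
  have hBS : B ∪ S = ball G r (m + 1) := Finset.sdiff_union_of_subset hSball
  have hxB : x ∈ B := Finset.mem_sdiff.mpr ⟨(mem_ball hG).mpr (by omega), hxS⟩
  have hpB : p ∈ B := Finset.mem_sdiff.mpr ⟨(mem_ball hG).mpr (by omega), hpS⟩
  let R : (V → unitInterval) → ℝ≥0∞ := fun σ => edgeWeight G (kernel n θ) (B.erase x) σ *
      ∏ y ∈ sphere G r (m + 1) \ S, q y (σ y)
  have hRm : Measurable R := (measurable_edgeWeight (measurable_kernel n θ) _).mul
    (Finset.measurable_prod _ fun y _ => (hq y).comp (measurable_pi_apply y))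
  have hRdep : DependsOn R (B.erase x) := by
    intro σ τ hστ
    simp only [R]
    rw [dependsOn_edgeWeight _ hστ]
    congr 1
    refine Finset.prod_congr rfl fun y hy => ?_
    rw [Finset.mem_sdiff, mem_sphere hG] at hy
    rw [hστ y]
    refine Finset.mem_coe.mpr (Finset.mem_erase.mpr ⟨?_, Finset.mem_sdiff.mpr
      ⟨(mem_ball hG).mpr hy.1.le, hy.2⟩⟩)
    rintro rfl
    omega
  have hker : Measurable fun σ : V → unitInterval => kernel n θ s(σ p, σ x) :=
    measurable_comp_pair (κ := fun u v => kernel n θ s(u, v)) (measurable_kernel n θ) p x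
  have hdecomp : ∀ σ, ballWeight G (kernel n θ) r q (m + 1) σ =
      kernel n θ s(σ p, σ x) * R σ * ∏ y ∈ S, (kernel n θ s(σ x, σ y) * q y (σ y)) := by
    intro σ
    have hu1 : ∀ y ∈ S, ∀ z ∈ B ∪ S, G.Adj y z → z = x := by
      intro y hy z hz hyz
      rw [hBS, mem_ball hG] at hz
      have hy' := hSd y hy
      refine lower_unique hG hyz ?_ (hSmem.mp hy).1.symm (r := r) (by omega)
      rcases hG.dist_eq_dist_add_one_of_adj r hyz with h | h <;> omega
    have hu2 : ∀ z ∈ B.erase x, G.Adj x z → z = p := by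
      intro z hz hxz
      by_contra hzp
      exact (Finset.mem_sdiff.mp (Finset.mem_of_mem_erase hz)).2 (hSmem.mpr ⟨hxz, hzp⟩)
    have he := edgeWeight_insert (κ := kernel n θ) (Finset.notMem_erase x B)
      (Finset.mem_erase.mpr ⟨hxp.symm.ne, hpB⟩) hxp.symm hu2 σ
    rw [Finset.insert_erase hxB] at he
    rw [ballWeight, ← hBS, edgeWeight_union_pendants hxB Finset.sdiff_disjoint
      (fun y hy => (hSmem.mp hy).1) hu1, he, ← Finset.prod_sdiff hSsph, Finset.prod_mul_distrib]
    simp only [R]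
    ring
  have hQm : ∀ y, Measurable fun u => ∫⁻ v, kernel n θ s(u, v) * q y v := fun y =>
    ((measurable_kernel n θ).mul ((hq y).comp measurable_snd)).lintegral_prod_right'
  have hQ0 : ∀ y u, ∫⁻ v, kernel n θ s(u, v) * q y v ≠ 0 := fun y u =>
    lintegral_ne_zero_of_ne_zero ((measurable_kernel_left n θ u).mul (hq y))
      fun v => mul_ne_zero (kernel_ne_zero n θ _) (hq0 y v)
  have hRx : ∀ σ v, R (Function.update σ x v) = R σ :=
    update_eq_of_dependsOn hRdep (by simp)
  refine condMeasure_eq_of_hasWeight hθ hpB hxB (Finset.measurable_prod _ fun y _ => hQm y)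
    (fun u => Finset.prod_ne_zero_iff.mpr fun y _ => hQ0 y u) hRm hRx ?_
  obtain ⟨c, hc, hc', H⟩ := h
  refine ⟨c, hc, hc', fun F hF hFB => ?_⟩
  rw [H F hF (hFB.mono (by exact_mod_cast Finset.sdiff_subset))]
  congr 1
  have e1 : ∀ σ, F σ * ballWeight G (kernel n θ) r q (m + 1) σ =
      F σ * (kernel n θ s(σ p, σ x) * R σ) *
        ∏ y ∈ S, (kernel n θ s(σ x, σ y) * q y (σ y)) := fun σ => by
    rw [hdecomp, ← mul_assoc]
  simp only [e1]
  rw [lintegral_pendants (κ := fun u v => kernel n θ s(u, v))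
    (R := fun σ => F σ * (kernel n θ s(σ p, σ x) * R σ)) (measurable_kernel n θ) hq hxS
    (hF.mul (hker.mul hRm))]
  · refine lintegral_congr fun σ => ?_
    ring
  · intro y hy σ v
    have hyB : y ∉ B := fun h => (Finset.mem_sdiff.mp h).2 hy
    have hRy : R (Function.update σ y v) = R σ :=
      update_eq_of_dependsOn hRdep (by simp [hyB]) σ v
    have hyp : p ≠ y := fun h => hpS (h ▸ hy)
    have hyx : x ≠ y := fun h => hxS (h ▸ hy)
    rw [update_eq_of_dependsOn hFB (by simpa using hyB), hRy, Function.update_of_ne hyp,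
      Function.update_of_ne hyx]

end BallWeight

/-! ### Recovering the parameter `s` from the removed-edge law. -/

section Density

open scoped ENNReal

variable {n k : ℕ} {θ s : ℝ}

theorem integral_smul_withDensity_tilt (hs : |s| < 1) (c : ℝ≥0∞) (f : unitInterval → ℝ) :
    ∫ u, f u ∂(c • (volume : Measure unitInterval).withDensity fun u => tilt n s u ^ k) =
      c.toReal * ∫ u, f u * (1 + s * spin n u) ^ k := by
  rw [integral_smul_measure, integral_withDensity_eq_integral_toReal_smul
    ((measurable_tilt n s).pow_const k) (ae_of_all _ fun u =>
      ENNReal.pow_lt_top (lt_of_le_of_lt (tilt_le hs u) (by finiteness))), smul_eq_mul]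
  congr 1
  refine integral_congr_ae (ae_of_all _ fun u => ?_)
  simp only [smul_eq_mul]
  rw [ENNReal.toReal_pow, tilt, ENNReal.toReal_ofReal (one_add_mul_pos hs (abs_spin_le n u)).le,
    mul_comm]

/-- Both sides of the equation scale with Λ, so the unknown constant `c` cancels. -/
theorem isFixed_iff_of_eq_withDensity_tilt (hs : |s| < 1) {c : ℝ≥0∞} (hc : c ≠ 0) (hc' : c ≠ ⊤)
    {Λ : Measure unitInterval} (h : Λ = c • volume.withDensity fun u => tilt n s u ^ k) :
    IsFixed n k θ s ↔ s * Λ.real Set.univ = θ * ∫ u, spin n u ∂Λ := by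
  have h1 : Λ.real Set.univ = c.toReal * ∫ u, (1 + s * spin n u) ^ k := by
    have := integral_smul_withDensity_tilt (n := n) (k := k) hs c fun _ => 1
    rw [← h] at this
    simpa using this
  have h2 : ∫ u, spin n u ∂Λ = c.toReal * ∫ u, spin n u * (1 + s * spin n u) ^ k := by
    rw [h, integral_smul_withDensity_tilt hs]
  have hc0 : c.toReal ≠ 0 := ENNReal.toReal_ne_zero.mpr ⟨hc, hc'⟩
  rw [IsFixed, h1, h2, mul_left_comm, mul_left_comm θ, mul_right_inj' hc0]

theorem integrable_spin (Λ : Measure unitInterval) [IsFiniteMeasure Λ] :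
    Integrable (spin n) Λ :=
  Integrable.of_bound (measurable_spin n).aestronglyMeasurable 1 (ae_of_all _ (abs_spin_le n))

/-- The kernel maps a finite measure to a multiple of a tilt. -/
theorem exists_lintegral_kernel_eq (hθ : |θ| < 1) {Λ : Measure unitInterval} [IsFiniteMeasure Λ]
    (hΛ : Λ Set.univ ≠ 0) : ∃ s a : ℝ, |s| < 1 ∧ 0 < a ∧
      s * Λ.real Set.univ = θ * ∫ u, spin n u ∂Λ ∧
      ∀ u, ∫⁻ v, kernel n θ s(u, v) ∂Λ = ENNReal.ofReal a * tilt n s u := by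
  have ha : 0 < Λ.real Set.univ :=
    ENNReal.toReal_pos hΛ (measure_ne_top _ _)
  have hb : |∫ u, spin n u ∂Λ| ≤ Λ.real Set.univ := by
    refine (abs_integral_le_integral_abs).trans ?_
    calc ∫ u, |spin n u| ∂Λ ≤ ∫ _, 1 ∂Λ :=
          integral_mono (integrable_spin Λ).abs (integrable_const 1) (abs_spin_le n)
      _ = Λ.real Set.univ := by simp
  -- The parameter is θ times the mean spin under the normalized Λ, hence at most |θ| in absolute
  -- value.
  refine ⟨θ * (∫ u, spin n u ∂Λ) / Λ.real Set.univ, Λ.real Set.univ, ?_, ha,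
    div_mul_cancel₀ _ ha.ne', fun u => ?_⟩
  · rw [abs_div, abs_of_pos ha, div_lt_one ha, abs_mul]
    calc |θ| * |∫ u, spin n u ∂Λ| ≤ |θ| * Λ.real Set.univ := by gcongr
      _ < 1 * Λ.real Set.univ := by gcongr
      _ = _ := one_mul _
  · have hint : Integrable (fun v => 1 + θ * (spin n u * spin n v)) Λ :=
      (integrable_const 1).add (((integrable_spin Λ).const_mul _).const_mul _)
    simp only [kernel_mk hθ]
    rw [← ofReal_integral_eq_lintegral_ofReal hint (ae_of_all _ fun v =>
      (one_add_mul_pos hθ (abs_spin_mul_le n u v)).le), tilt, ← ENNReal.ofReal_mul ha.le,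
      integral_add (integrable_const 1) (((integrable_spin Λ).const_mul _).const_mul _),
      integral_const_mul, integral_const_mul]
    congr 1
    simp only [integral_const, smul_eq_mul, mul_one]
    field_simp

end Density

/-! ### Invariant splitting Gibbs measures correspond to solutions. -/

section Classification

open scoped ENNReal

variable {V : Type*} {G : SimpleGraph V} [G.LocallyFinite] {n k : ℕ} {θ s : ℝ}

theorem condMeasure_eq_of_isTranslationInvariant (hG : G.IsTree) {d : ℕ}
    (hreg : G.IsRegularOfDegree d) {μ : Measure (V → unitInterval)}
    (hμ : IsTranslationInvariant G μ) {p x p' x' : V} (h : G.Adj p x) (h' : G.Adj p' x') :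
    condMeasure n θ μ p x = condMeasure n θ μ p' x' := by
  obtain ⟨φ, rfl, rfl⟩ := exists_iso_of_adj hG hreg h h'
  exact (condMeasure_map hμ φ p x).symm

theorem exists_adj (hreg : G.IsRegularOfDegree (k + 1)) (r : V) : ∃ x, G.Adj r x := by
  have : 0 < (G.neighborFinset r).card := by
    rw [SimpleGraph.card_neighborFinset_eq_degree, hreg r]; omega
  obtain ⟨x, hx⟩ := Finset.card_pos.mp this
  exact ⟨x, by simpa using hx⟩

/-- The same Λ is computed on the sphere, where it gives every boundary factor, and one step inside,
where it is a power of a tilt. Comparing the two yields the equation. -/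
theorem exists_isFixed_of_isSplittingGibbs (hG : G.IsTree) (hreg : G.IsRegularOfDegree (k + 1))
    (hθ : |θ| < 1) {r : V} {μ : Measure (V → unitInterval)}
    (hμ : IsSplittingGibbs G (potential n θ) 1 r μ) (hTI : IsTranslationInvariant G μ) :
    ∃ s, |s| < 1 ∧ IsFixed n k θ s ∧
      ∀ m, 1 ≤ m → HasWeight μ (ball G r m) (treeWeight G n θ s (ball G r m)) := by
  classical
  rw [isSplittingGibbs_iff hG (measurable_potential n θ)] at hμ
  obtain ⟨hprob, h, hh, hW⟩ := hμ
  set q : V → unitInterval → ℝ≥0∞ := fun x u => ENNReal.ofReal (Real.exp (h x u)) with hqdef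
  have hq : ∀ x, Measurable (q x) := fun x => (Real.measurable_exp.comp (hh x)).ennreal_ofReal
  have hq0 : ∀ x u, q x u ≠ 0 := fun x u => (ENNReal.ofReal_pos.mpr (Real.exp_pos _)).ne'
  have hW : ∀ m, 1 ≤ m → HasWeight μ (ball G r m) (ballWeight G (kernel n θ) r q m) := hW
  obtain ⟨x₁, hx₁⟩ := exists_adj hreg r
  set Λ := condMeasure n θ μ r x₁ with hΛ
  have hΛfin : IsFiniteMeasure Λ := isFiniteMeasure_condMeasure hθ μ r x₁
  have hb : ∀ x, x ≠ r → ∃ c : ℝ≥0∞, c ≠ 0 ∧ c ≠ ⊤ ∧ Λ = c • volume.withDensity (q x) := by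
    intro x hx
    obtain ⟨p, hxp, hd⟩ := exists_lower_adj hG hx
    obtain ⟨c, hc, hc', H⟩ := condMeasure_eq_boundary hG hθ hq hq0 hxp hd (hW _ (by omega))
    exact ⟨c, hc, hc',
      (condMeasure_eq_of_isTranslationInvariant hG hreg hTI hx₁ hxp.symm).trans H⟩
  obtain ⟨s, a, hs, ha, hsΛ, hker⟩ :=
    exists_lintegral_kernel_eq (n := n) hθ (Λ := Λ) (condMeasure_univ_ne_zero μ r x₁)
  have hQ : ∀ y, y ≠ r → ∃ c : ℝ≥0∞, c ≠ 0 ∧ c ≠ ⊤ ∧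
      ∀ u, ∫⁻ v, kernel n θ s(u, v) * q y v = c * tilt n s u := by
    intro y hy
    obtain ⟨c, hc, hc', H⟩ := hb y hy
    have ha0 : ENNReal.ofReal a ≠ 0 := (ENNReal.ofReal_pos.mpr ha).ne'
    refine ⟨c⁻¹ * ENNReal.ofReal a, mul_ne_zero (ENNReal.inv_ne_zero.mpr hc') ha0,
      ENNReal.mul_ne_top (ENNReal.inv_ne_top.mpr hc) ENNReal.ofReal_ne_top, fun u => ?_⟩
    rw [mul_assoc, ← hker u, H, lintegral_smul_measure,
      lintegral_withDensity_eq_lintegral_mul _ (hq y) (measurable_kernel_left n θ u), smul_eq_mul,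
      ← mul_assoc, ENNReal.inv_mul_cancel hc hc', one_mul]
    simp only [Pi.mul_apply, mul_comm]
  have hΛs : ∃ C : ℝ≥0∞, C ≠ 0 ∧ C ≠ ⊤ ∧
      Λ = C • volume.withDensity fun u => tilt n s u ^ k := by
    have hd1 : G.dist r x₁ = 1 := SimpleGraph.dist_eq_one_iff_adj.mpr hx₁
    obtain ⟨c, hc, hc', H⟩ := condMeasure_eq_interior hG hθ hq hq0 hx₁.symm (by simp [hd1])
      (hW (G.dist r x₁ + 1) (by omega))
    have hd : ∀ y, ∃ d : ℝ≥0∞, y ≠ r → d ≠ 0 ∧ d ≠ ⊤ ∧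
        ∀ u, ∫⁻ v, kernel n θ s(u, v) * q y v = d * tilt n s u := by
      intro y
      by_cases hy : y = r
      · exact ⟨0, fun h => absurd hy h⟩
      · obtain ⟨d, hd⟩ := hQ y hy
        exact ⟨d, fun _ => hd⟩
    choose d hd using hd
    have hcard : ((G.neighborFinset x₁).erase r).card = k := by
      rw [Finset.card_erase_of_mem (by simpa using hx₁.symm),
        SimpleGraph.card_neighborFinset_eq_degree, hreg x₁]
      rfl
    refine ⟨c * ∏ y ∈ (G.neighborFinset x₁).erase r, d y, mul_ne_zero hc
      (Finset.prod_ne_zero_iff.mpr fun y hy => (hd y (Finset.ne_of_mem_erase hy)).1),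
      ENNReal.mul_ne_top hc'
      (ENNReal.prod_ne_top fun y hy => (hd y (Finset.ne_of_mem_erase hy)).2.1), ?_⟩
    rw [hΛ, H, mul_smul, ← withDensity_smul _ ((measurable_tilt n s).pow_const k)]
    congr 2
    funext u
    rw [Finset.prod_congr rfl fun y hy => (hd y (Finset.ne_of_mem_erase hy)).2.2 u,
      Finset.prod_mul_distrib, Finset.prod_const, hcard]
    rfl
  obtain ⟨C, hC, hC', hΛC⟩ := hΛs
  refine ⟨s, hs, (isFixed_iff_of_eq_withDensity_tilt hs hC hC' hΛC).mpr hsΛ, fun m hm => ?_⟩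
  -- Equal measures determine the boundary factors only almost everywhere, so the weights are
  -- compared up to `ref V`-null sets.
  have hae : ∀ x, ∃ c : ℝ≥0∞, x ≠ r → c ≠ 0 ∧ c ≠ ⊤ ∧
      q x =ᵐ[volume] fun u => c * tilt n s u ^ k := by
    intro x
    by_cases hx : x = r
    · exact ⟨0, fun h => absurd hx h⟩
    obtain ⟨c, hc, hc', H⟩ := hb x hx
    refine ⟨c⁻¹ * C, fun _ => ⟨mul_ne_zero (ENNReal.inv_ne_zero.mpr hc') hC,
      ENNReal.mul_ne_top (ENNReal.inv_ne_top.mpr hc) hC', ?_⟩⟩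
    rw [hΛC, ← withDensity_smul _ ((measurable_tilt n s).pow_const k),
      ← withDensity_smul _ (hq x), withDensity_eq_iff_of_sigmaFinite
      (((measurable_tilt n s).pow_const k).const_smul C).aemeasurable
      ((hq x).const_smul c).aemeasurable] at H
    refine H.mono fun u hu => ?_
    simp only [Pi.smul_apply, smul_eq_mul] at hu
    simp only
    rw [mul_assoc, hu, ← mul_assoc, ENNReal.inv_mul_cancel hc hc', one_mul]
  choose c hc using hae
  have hne : ∀ x ∈ sphere G r m, x ≠ r := by
    rintro x hx rfl
    rw [mem_sphere hG, SimpleGraph.dist_self] at hx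
    omega
  refine (hW m hm).congr_ae (a := ∏ x ∈ sphere G r m, c x)
    (Finset.prod_ne_zero_iff.mpr fun x hx => (hc x (hne x hx)).1)
    (ENNReal.prod_ne_top fun x hx => (hc x (hne x hx)).2.1) (measurable_treeWeight _) ?_
  have hall : ∀ᵐ σ ∂ref V, ∀ x ∈ sphere G r m, q x (σ x) = c x * tilt n s (σ x) ^ k := by
    rw [Filter.eventually_all_finset]
    intro x hx
    exact (measurePreserving_eval_infinitePi
      (fun _ : V => (volume : Measure unitInterval)) x).quasiMeasurePreserving.ae
      (hc x (hne x hx)).2.2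
  refine hall.mono fun σ hσ => ?_
  simp only
  rw [← ballWeight_eq_treeWeight hG hreg r hm, ballWeight, ballWeight,
    Finset.prod_congr rfl hσ, Finset.prod_mul_distrib]
  ring

/-- The law `condMeasure` depends on μ alone, and `s` is θ times its mean spin. -/
theorem eq_of_hasWeight_treeWeight (hG : G.IsTree) (hreg : G.IsRegularOfDegree (k + 1))
    (hθ : |θ| < 1) {r : V} {μ : Measure (V → unitInterval)} [IsProbabilityMeasure μ] {s' : ℝ}
    (hs : |s| < 1) (hs' : |s'| < 1) (hfix : IsFixed n k θ s) (hfix' : IsFixed n k θ s')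
    (h : HasWeight μ (ball G r 1) (treeWeight G n θ s (ball G r 1)))
    (h' : HasWeight μ (ball G r 1) (treeWeight G n θ s' (ball G r 1))) : s = s' := by
  obtain ⟨x, hx⟩ := exists_adj hreg r
  have hd : G.dist r x = 1 := SimpleGraph.dist_eq_one_iff_adj.mpr hx
  have key : ∀ t : ℝ, |t| < 1 → IsFixed n k θ t →
      HasWeight μ (ball G r 1) (treeWeight G n θ t (ball G r 1)) →
      t * (condMeasure n θ μ r x).real Set.univ = θ * ∫ u, spin n u ∂condMeasure n θ μ r x := by
    intro t ht hft hw
    rw [← funext (ballWeight_eq_treeWeight hG hreg r le_rfl), ← hd] at hw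
    obtain ⟨c, hc, hc', H⟩ := condMeasure_eq_boundary hG hθ
      (fun _ => (measurable_tilt n t).pow_const k)
      (fun _ u => pow_ne_zero k (tilt_ne_zero ht u)) hx.symm (by simp [hd]) hw
    exact (isFixed_iff_of_eq_withDensity_tilt ht hc hc' H).mp hft
  have hpos : (condMeasure n θ μ r x).real Set.univ ≠ 0 := by
    have := isFiniteMeasure_condMeasure (n := n) hθ μ r x
    exact ENNReal.toReal_ne_zero.mpr ⟨condMeasure_univ_ne_zero μ r x, measure_ne_top _ _⟩
  exact mul_right_cancel₀ hpos ((key s hs hfix h).trans (key s' hs' hfix' h').symm)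

/-- The translation-invariant splitting Gibbs measures correspond to the solutions of the
self-consistency equation. -/
theorem exists_equiv_isFixed (hG : G.IsTree) (hreg : G.IsRegularOfDegree (k + 1))
    (hθ : |θ| < 1) (r : V) (hfix : ∀ s, IsFixed n k θ s → |s| < 1) :
    ∃ M : ℝ → Measure (V → unitInterval), Set.InjOn M {s | IsFixed n k θ s} ∧
      {μ | IsSplittingGibbs G (potential n θ) 1 r μ ∧ IsTranslationInvariant G μ} =
        M '' {s | IsFixed n k θ s} := by
  have hex : ∀ s, ∃ μ : Measure (V → unitInterval), IsFixed n k θ s → IsProbabilityMeasure μ ∧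
      ∀ m, HasWeight μ (ball G r m) (treeWeight G n θ s (ball G r m)) := by
    intro s
    by_cases hs : IsFixed n k θ s
    · obtain ⟨μ, hμ⟩ := exists_hasWeight_treeWeight hG hreg hθ (hfix s hs) hs r
      exact ⟨μ, fun _ => hμ⟩
    · exact ⟨0, fun h => absurd h hs⟩
  choose M hM using hex
  refine ⟨M, fun s hs s' hs' hss' => ?_, Set.ext fun μ => ⟨?_, ?_⟩⟩
  · have := (hM s hs).1
    exact eq_of_hasWeight_treeWeight hG hreg hθ (hfix s hs) (hfix s' hs') hs hs' ((hM s hs).2 1)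
      (hss' ▸ (hM s' hs').2 1)
  · rintro ⟨hμ, hTI⟩
    obtain ⟨s, -, hs, hw⟩ := exists_isFixed_of_isSplittingGibbs hG hreg hθ hμ hTI
    have := (hM s hs).1
    have := hμ.1
    exact ⟨s, hs, eq_of_hasWeight_ball hG (fun m _ => (hM s hs).2 m) hw⟩
  · rintro ⟨s, hs, rfl⟩
    have := (hM s hs).1
    exact ⟨isSplittingGibbs_of_hasWeight hG hreg (hfix s hs) fun m _ => (hM s hs).2 m,
      isTranslationInvariant_of_hasWeight hG hreg hθ (hfix s hs) hs fun m _ => (hM s hs).2 m⟩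

end Classification

end CayleyTree

theorem theorem1 {V : Type*} (G : SimpleGraph V) [G.LocallyFinite] (k : ℕ) (hk : 2 ≤ k)
    (hG : G.IsTree) (hreg : G.IsRegularOfDegree (k + 1)) (x₀ : V)
    (n : ℕ) (θ : ℝ) (hθ₀ : 0 ≤ θ) (hθ₁ : θ < 1) :
    (θ ≤ (2 * (n : ℝ) + 3) / ((k : ℝ) * (2 * (n : ℝ) + 1)) →
      ∃! μ : Measure (V → unitInterval),
        IsSplittingGibbs G (potential n θ) 1 x₀ μ ∧ IsTranslationInvariant G μ) ∧
    ((2 * (n : ℝ) + 3) / ((k : ℝ) * (2 * (n : ℝ) + 1)) < θ →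
      {μ : Measure (V → unitInterval) |
        IsSplittingGibbs G (potential n θ) 1 x₀ μ ∧ IsTranslationInvariant G μ}.ncard = 3) := by
  have hθ : |θ| < 1 := by rwa [abs_of_nonneg hθ₀]
  constructor
  · intro h
    have hiff := fun s => CayleyTree.isFixed_iff_of_le (n := n) hk hθ₀ h (s := s)
    obtain ⟨M, -, hM⟩ := CayleyTree.exists_equiv_isFixed (n := n) hG hreg hθ x₀
      fun s hs => by rw [(hiff s).mp hs]; simp
    have hset : {s | CayleyTree.IsFixed n k θ s} = {0} := Set.ext hiff
    rw [hset, Set.image_singleton] at hM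
    exact ⟨M 0, hM.symm.subset rfl, fun μ hμ => hM.subset hμ⟩
  · intro h
    obtain ⟨z, hz, hz1, hiff⟩ := CayleyTree.exists_isFixed_iff_of_lt hk hθ₀ hθ₁ h
    obtain ⟨M, hinj, hM⟩ := CayleyTree.exists_equiv_isFixed (n := n) hG hreg hθ x₀ fun s hs => by
      rcases (hiff s).mp hs with rfl | rfl | rfl
      · simp
      · rwa [abs_of_pos hz]
      · rwa [abs_neg, abs_of_pos hz]
    have hset : {s | CayleyTree.IsFixed n k θ s} = {0, z, -z} := Set.ext hiff
    rw [hM, hinj.ncard_image, hset, Set.ncard_eq_three]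
    exact ⟨0, z, -z, hz.ne, (neg_lt_zero.mpr hz).ne', (by linarith : -z < z).ne', rfl⟩
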